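/- **Conventions.** For a countable first-order language $\mathcal L$ (relation, function and constant symbols allowed), $\mathrm{Mod}(\mathcal L)$ is the standard Borel space of all $\mathcal L$-structures with domain $\omega$. An $\mathcal L_{\omega_1\omega}$-elementary class is a set $\mathcal C\subseteq \mathrm{Mod}(\mathcal L)$ consisting of all models with domain $\omega$ of some sentence of the infinitary logic $\mathcal L_{\omega_1\omega}$, and $\cong_{\mathcal C}$ is the relation of isomorphism on $\mathcal C$. For equivalence relations $E,F$ on standard Borel spaces $X,Y$, write $E\le_B F$ if there is a Borel map $f:X\to Y$ with $x\mathrel E x'\iff f(x)\mathrel F f(x')$ for all $x,x'\in X$; $E\sim_B F$ if $E\le_B F$ and $F\le_B E$; and $E\simeq_{cB}F$ if there is a bijection $h:X/E\to Y/F$ such that both $h$ and $h^{-1}$ admit Borel liftings $X\to Y$, $Y\to X$. An *isomorphism relation* is a relation of the form $\cong_{\mathcal D}$, for $\mathcal D$ an $\mathcal L'_{\omega_1\omega}$-elementary class in some countable language $\mathcal L'$ (up to a Borel isomorphism of the underlying spaces); a *quasi-isomorphism relation* is an equivalence relation on a standard Borel space which is Borel bireducible ($\sim_B$) with some isomorphism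 relation. For structures $z_1,z_2$ in the same language, $z_1\preceq^{wepi}z_2$ means that there is a surjection from the domain of $z_2$ onto the domain of $z_1$ which preserves functions, and preserves relations in the direction from $z_2$ to $z_1$ (a weak-epimorphism of $z_2$ onto $z_1$). An *ordered set-theoretical tree* is a structure with two binary relations, the first of which is a strict partial order such that the set of predecessors of each element is well-ordered by it, and the second of which is transitive. **Theorem.** Let $\mathcal L$ be the language consisting of two binary relation symbols, and let $E$ be a quasi-isomorphism relation. Then there is an $\mathcal L_{\omega_1\omega}$-elementary class $\mathcal C$, consisting of ordered set-theoretical trees, such that $E\sim_B{\cong_{\mathcal C}}$ and $z_1\preceq^{wepi}z_2$ for all $z_1,z_2\in\mathcal C$. Moreover, if $E$ itself is an isomorphism relation, then $\mathcal C$ satisfies $E\simeq_{cB}{\cong_{\mathcal C}}$. -/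

import Mathlib

namespace BorelClass

section Logic

/-- Formulas of the infinitary logic `L_{ω₁ω}` with free variables among `v_0, …, v_{n-1}`:
first-order formulas with, in addition, conjunctions of countably many formulas. Terms are
Mathlib's first-order terms. The quantifier `all` binds the last variable `v_n`. The other
connectives (countable disjunctions, existential quantifiers, …) are the usual abbreviations. -/
inductive InfFormula (L : FirstOrder.Language.{0, 0}) : ℕ → Type
  | falsum {n : ℕ} : InfFormula L n
  | equal {n : ℕ} (s t : L.Term (Fin n)) : InfFormula L n
  | rel {n k : ℕ} (R : L.Relations k) (ts : Fin k → L.Term (Fin n)) : InfFormula L n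
  | imp {n : ℕ} (φ ψ : InfFormula L n) : InfFormula L n
  | conj {n : ℕ} (φ : ℕ → InfFormula L n) : InfFormula L n
  | all {n : ℕ} (φ : InfFormula L (n + 1)) : InfFormula L n

/-- Satisfaction of an `L_{ω₁ω}`-formula in a structure under an assignment. -/
def InfFormula.Realize {L : FirstOrder.Language.{0, 0}} {M : Type} [L.Structure M] :
    {n : ℕ} → InfFormula L n → (Fin n → M) → Prop
  | _, .falsum, _ => False
  | _, .equal s t, v => s.realize v = t.realize v
  | _, .rel R ts, v => FirstOrder.Language.Structure.RelMap R (fun i => (ts i).realize v)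
  | _, .imp φ ψ, v => φ.Realize v → ψ.Realize v
  | _, .conj φ, v => ∀ i, (φ i).Realize v
  | _, .all φ, v => ∀ a : M, φ.Realize (Fin.snoc v a : Fin _ → M)

/-- The space `Mod(L)` of `L`-structures with domain `ℕ`. -/
abbrev Mod (L : FirstOrder.Language.{0, 0}) : Type := L.Structure ℕ

/-- The list of all values of the function symbols and all truth values of the relation symbols:
this identifies `Mod(L)` with a product of copies of `ℕ` and of the two-point set. -/
def Mod.code {L : FirstOrder.Language.{0, 0}} (x : Mod L) :
    ((Σ n, L.Functions n × (Fin n → ℕ)) → ℕ) × ((Σ n, L.Relations n × (Fin n → ℕ)) → Prop) :=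
  (fun p => x.funMap p.2.1 p.2.2, fun p => x.RelMap p.2.1 p.2.2)

/-- The product σ-algebra (with discrete factors) on `Mod(L)`. For a countable language this is
the σ-algebra of Borel sets of the usual Polish topology on `Mod(L)`. -/
instance Mod.instMeasurableSpace (L : FirstOrder.Language.{0, 0}) : MeasurableSpace (Mod L) :=
  MeasurableSpace.comap Mod.code inferInstance

/-- Satisfaction of a sentence in an element of `Mod(L)`. -/
def Mod.Sat {L : FirstOrder.Language.{0, 0}} (x : Mod L) (φ : InfFormula L 0) : Prop :=
  @InfFormula.Realize L ℕ x 0 φ Fin.elim0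

/-- `C ⊆ Mod(L)` is an `L_{ω₁ω}`-elementary class: the set of all models (with domain `ℕ`) of some
`L_{ω₁ω}`-sentence. -/
def IsElementaryClass {L : FirstOrder.Language.{0, 0}} (C : Set (Mod L)) : Prop :=
  ∃ φ : InfFormula L 0, C = {x | x.Sat φ}

/-- Isomorphism of two elements of `Mod(L)`. -/
def Mod.Iso {L : FirstOrder.Language.{0, 0}} (x y : Mod L) : Prop :=
  Nonempty (@FirstOrder.Language.Equiv L ℕ ℕ x y)

/-- The relation of isomorphism on a class `C ⊆ Mod(L)`. -/
def isoRel {L : FirstOrder.Language.{0, 0}} (C : Set (Mod L)) : Setoid C where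
  r x y := Mod.Iso x.1 y.1
  iseqv :=
    { refl := fun x => ⟨@FirstOrder.Language.Equiv.refl L ℕ x.1⟩
      symm := fun {x y} h => h.elim fun e => ⟨@FirstOrder.Language.Equiv.symm L ℕ ℕ x.1 y.1 e⟩
      trans := fun {x y z} h h' => h.elim fun e => h'.elim fun e' =>
        ⟨@FirstOrder.Language.Equiv.comp L ℕ ℕ x.1 y.1 ℕ z.1 e' e⟩ }

/-- `x ⪯ y`: there is a weak-epimorphism of `y` onto `x`, that is, a surjection which preserves
functions, and preserves relations in the forward direction (`FirstOrder.Language.Hom`). -/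
def Mod.WeakEpiLE {L : FirstOrder.Language.{0, 0}} (x y : Mod L) : Prop :=
  ∃ h : @FirstOrder.Language.Hom L ℕ ℕ y x,
    Function.Surjective (@FirstOrder.Language.Hom.toFun L ℕ ℕ y x h)

end Logic

section Reducibility

variable {X Y : Type*} [MeasurableSpace X] [MeasurableSpace Y]

/-- `E ≤_B F`: there is a Borel function reducing `E` to `F`. -/
def BorelReducible (E : Setoid X) (F : Setoid Y) : Prop :=
  ∃ f : X → Y, Measurable f ∧ ∀ x x', E x x' ↔ F (f x) (f x')

/-- `E ∼_B F`: Borel bireducibility. -/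
def BorelBireducible (E : Setoid X) (F : Setoid Y) : Prop :=
  BorelReducible E F ∧ BorelReducible F E

/-- `E ≃_cB F`: there is a bijection between the quotients which has a Borel lifting and whose
inverse has a Borel lifting. -/
def ClasswiseBorelIsomorphic (E : Setoid X) (F : Setoid Y) : Prop :=
  ∃ h : Quotient E ≃ Quotient F,
    (∃ f : X → Y, Measurable f ∧ ∀ x, h (Quotient.mk E x) = Quotient.mk F (f x)) ∧
    ∃ g : Y → X, Measurable g ∧ ∀ y, h.symm (Quotient.mk F y) = Quotient.mk E (g y)

/-- `E` is a quasi-isomorphism relation: it is Borel bireducible with the isomorphism relation on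
some `L_{ω₁ω}`-elementary class, in some countable language `L`. -/
def IsQuasiIsomorphismRelation (E : Setoid X) : Prop :=
  ∃ (L : FirstOrder.Language.{0, 0}) (_ : Countable L.Symbols) (C : Set (Mod L)),
    IsElementaryClass C ∧ BorelBireducible E (isoRel C)

/-- `E` is an isomorphism relation: up to a Borel isomorphism of the underlying spaces, `E` is the
isomorphism relation on some `L_{ω₁ω}`-elementary class, in some countable language `L`. -/
def IsIsomorphismRelation (E : Setoid X) : Prop :=
  ∃ (L : FirstOrder.Language.{0, 0}) (_ : Countable L.Symbols) (C : Set (Mod L)),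
    IsElementaryClass C ∧ ∃ e : X ≃ᵐ C, ∀ x x', E x x' ↔ isoRel C (e x) (e x')

end Reducibility

section OrderedTrees

/-- The two binary relation symbols of the language of ordered graphs. -/
inductive OrderedGraphRel : ℕ → Type
  | edge : OrderedGraphRel 2
  | order : OrderedGraphRel 2

/-- The language of ordered graphs: two binary relation symbols. -/
def orderedGraphLang : FirstOrder.Language.{0, 0} := ⟨fun _ => Empty, OrderedGraphRel⟩

/-- The interpretation of the first symbol. -/
def Mod.edge (x : Mod orderedGraphLang) (a b : ℕ) : Prop :=
  x.RelMap (n := 2) OrderedGraphRel.edge ![a, b]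

/-- The interpretation of the second symbol. -/
def Mod.order (x : Mod orderedGraphLang) (a b : ℕ) : Prop :=
  x.RelMap (n := 2) OrderedGraphRel.order ![a, b]

/-- An ordered set-theoretical tree: the first relation is a strict partial order in which the
predecessors of each node are well-ordered, and the second relation is transitive. -/
structure IsOrderedTree (x : Mod orderedGraphLang) : Prop where
  strictOrder : IsStrictOrder ℕ x.edge
  wellOrdered : ∀ t : ℕ, IsWellOrder {s : ℕ // x.edge s t} (fun a b => x.edge a.1 b.1)
  trans_order : ∀ a b c : ℕ, x.order a b → x.order b c → x.order a c

end OrderedTrees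

end BorelClass

/-! Replacing functions by their graphs turns a structure into a countable family `c` of relations
on ℕ. It is coded by a forest consisting of infinitely many isolated nodes, one ω-chain on which the
second relation is total (the universal chain), a node for each element, and an ω-chain for each
atomic formula `s(v)`. The second relation joins the `j`-th node of the latter chain to the element
`v j`; it has loops at the element nodes and, on that chain, at height `2 * idx s` always and at
height `2 * idx s + 1` exactly when `s(v)` is true. Heights are natural numbers, so the first
relation is tree-like.

Any two such forests are weak-epimorphic images of each other (`Coding.weakEpiLE`): the non-isolated
nodes collapse, height by height, into the universal chain, where the second relation always holds,
and the isolated nodes carry no relation at all, so they can be spread over the whole target.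

The shape and the parameters of a node can be read off by `L_{ω₁ω}`-formulas. Hence being isomorphic
to a coding forest is expressed by a sentence (`definable_isCoded`, `Coding.isCoded`,
`IsCoded.nonempty_coding`), the forest determines `c` up to isomorphism (`Coding.family_iso`), and
the sentence defining the given class can be relativised to the element nodes
(`Presents.codeRealize_iff`). The forests coding members of the class thus form an elementary class,
and encoding and decoding are Borel and inverse to each other up to isomorphism. -/

namespace BorelClass

/-! ### Closure properties of infinitary definability, and Borel measurability. -/

/-- A predicate of tuples in the elements of `Mod L` which is defined by an `L_{ω₁ω}`-formula. -/
def Definable {L : FirstOrder.Language.{0, 0}} (n : ℕ) (P : Mod L → (Fin n → ℕ) → Prop) : Prop :=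
  ∃ φ : InfFormula L n, ∀ (x : Mod L) (v : Fin n → ℕ), @InfFormula.Realize L ℕ x n φ v ↔ P x v

namespace Definable

variable {L : FirstOrder.Language.{0, 0}} {n : ℕ} {P Q : Mod L → (Fin n → ℕ) → Prop}

theorem congr (h : Definable n P) (hPQ : ∀ x v, P x v ↔ Q x v) : Definable n Q :=
  h.imp fun _ hφ x v => (hφ x v).trans (hPQ x v)

theorem false : Definable n (fun (_ : Mod L) _ => False) :=
  ⟨.falsum, fun x v => by simp [InfFormula.Realize]⟩

theorem imp (hP : Definable n P) (hQ : Definable n Q) : Definable n (fun x v => P x v → Q x v) := by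
  obtain ⟨φ, hφ⟩ := hP
  obtain ⟨ψ, hψ⟩ := hQ
  exact ⟨.imp φ ψ, fun x v => by simp [InfFormula.Realize, hφ, hψ]⟩

theorem not (hP : Definable n P) : Definable n (fun x v => ¬ P x v) := hP.imp false

theorem const (p : Prop) : Definable n (fun (_ : Mod L) _ => p) := by
  by_cases hp : p
  · exact (false.imp false).congr fun _ _ => by simp [hp]
  · exact false.congr fun _ _ => by simp [hp]

theorem and (hP : Definable n P) (hQ : Definable n Q) : Definable n (fun x v => P x v ∧ Q x v) :=
  (hP.imp hQ.not).not.congr fun _ _ => by tauto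

theorem or (hP : Definable n P) (hQ : Definable n Q) : Definable n (fun x v => P x v ∨ Q x v) :=
  (hP.not.imp hQ).congr fun _ _ => by tauto

theorem iff (hP : Definable n P) (hQ : Definable n Q) : Definable n (fun x v => P x v ↔ Q x v) :=
  ((hP.imp hQ).and (hQ.imp hP)).congr fun _ _ => by tauto

theorem iAll {ι : Type*} [Countable ι] {P : ι → Mod L → (Fin n → ℕ) → Prop}
    (h : ∀ i, Definable n (P i)) : Definable n (fun x v => ∀ i, P i x v) := by
  rcases isEmpty_or_nonempty ι with hι | hι
  · exact (const True).congr fun _ _ => by simp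
  obtain ⟨f, hf⟩ := exists_surjective_nat ι
  choose φ hφ using h
  exact ⟨.conj fun k => φ (f k), fun x v => by simp [InfFormula.Realize, hφ, hf.forall]⟩

theorem iEx {ι : Type*} [Countable ι] {P : ι → Mod L → (Fin n → ℕ) → Prop}
    (h : ∀ i, Definable n (P i)) : Definable n (fun x v => ∃ i, P i x v) :=
  (iAll fun i => (h i).not).not.congr fun _ _ => by simp

/-- The bound variable is the last entry of the assignment. In this form formulas are assembled by
unification, without being written down. -/
theorem all {P : Mod L → (Fin n → ℕ) → ℕ → Prop}
    (h : Definable (n + 1) (fun x v => P x (fun i => v i.castSucc) (v (Fin.last n)))) :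
    Definable n (fun x v => ∀ a, P x v a) := by
  obtain ⟨φ, hφ⟩ := h
  exact ⟨.all φ, fun x v => by simp [InfFormula.Realize, hφ]⟩

theorem ex {P : Mod L → (Fin n → ℕ) → ℕ → Prop}
    (h : Definable (n + 1) (fun x v => P x (fun i => v i.castSucc) (v (Fin.last n)))) :
    Definable n (fun x v => ∃ a, P x v a) :=
  (all (P := fun x v a => ¬ P x v a) h.not).not.congr fun _ _ => by simp

/-- A tuple is quantified one coordinate at a time, by induction on its length; this serves
quantification over the arguments of a symbol of arbitrary arity. -/
theorem allTuple {k : ℕ} {P : Mod L → (Fin n → ℕ) → (Fin k → ℕ) → Prop}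
    (h : Definable (n + k) (fun x v => P x (fun i => v (i.castAdd k)) (fun j => v (j.natAdd n)))) :
    Definable n (fun x v => ∀ w, P x v w) := by
  induction k with
  | zero =>
    refine h.congr fun x v => ⟨fun h w => ?_, fun h => h _⟩
    rwa [Subsingleton.elim w (fun j => v (j.natAdd n))]
  | succ k ih =>
    have h' : Definable n (fun x v => ∀ (w : Fin k → ℕ) (a : ℕ), P x v (Fin.snoc w a)) := by
      apply ih
      apply all
      refine h.congr fun x v => ?_
      have : (fun j : Fin (k + 1) => v (j.natAdd n)) =
          Fin.snoc (fun j : Fin k => v (j.natAdd n).castSucc) (v (Fin.last (n + k))) := by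
        funext j
        refine Fin.lastCases ?_ (fun j => ?_) j
        · simp
        · simp
      rw [this]
      rfl
    refine h'.congr fun x v => ⟨fun h w => ?_, fun h w a => h _⟩
    have := h (Fin.init w) (w (Fin.last k))
    rwa [Fin.snoc_init_self] at this

theorem exTuple {k : ℕ} {P : Mod L → (Fin n → ℕ) → (Fin k → ℕ) → Prop}
    (h : Definable (n + k) (fun x v => P x (fun i => v (i.castAdd k)) (fun j => v (j.natAdd n)))) :
    Definable n (fun x v => ∃ w, P x v w) :=
  (allTuple (P := fun x v w => ¬ P x v w) h.not).not.congr fun _ _ => by simp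

theorem eq (i j : Fin n) : Definable n (fun (_ : Mod L) v => v i = v j) :=
  ⟨.equal (.var i) (.var j), fun x v => by simp [InfFormula.Realize]⟩

theorem edge (i j : Fin n) : Definable n (fun x v => Mod.edge x (v i) (v j)) := by
  refine ⟨.rel OrderedGraphRel.edge ![.var i, .var j], fun x v => ?_⟩
  simp only [InfFormula.Realize, Mod.edge]
  refine iff_of_eq (congrArg _ (funext fun k => ?_))
  fin_cases k <;> rfl

theorem order (i j : Fin n) : Definable n (fun x v => Mod.order x (v i) (v j)) := by
  refine ⟨.rel OrderedGraphRel.order ![.var i, .var j], fun x v => ?_⟩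
  simp only [InfFormula.Realize, Mod.order]
  refine iff_of_eq (congrArg _ (funext fun k => ?_))
  fin_cases k <;> rfl

end Definable

theorem Mod.measurable_code {L : FirstOrder.Language.{0, 0}} :
    Measurable (Mod.code : Mod L → _) := comap_measurable _

theorem Mod.measurableSet_relMap {L : FirstOrder.Language.{0, 0}} {n : ℕ} (R : L.Relations n)
    (v : Fin n → ℕ) : MeasurableSet {x : Mod L | x.RelMap R v} := by
  have h : Measurable fun x : Mod L => (Mod.code x).2 ⟨n, R, v⟩ :=
    (measurable_pi_apply _).comp (measurable_snd.comp Mod.measurable_code)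
  exact measurableSet_setOfPred.2 h

theorem Mod.measurable_funMap {L : FirstOrder.Language.{0, 0}} {n : ℕ} (f : L.Functions n)
    (v : Fin n → ℕ) : Measurable fun x : Mod L => x.funMap f v := by
  have h : Measurable fun x : Mod L => (Mod.code x).1 ⟨n, f, v⟩ :=
    (measurable_pi_apply _).comp (measurable_fst.comp Mod.measurable_code)
  exact h

theorem Mod.measurable_of {L : FirstOrder.Language.{0, 0}} {Z : Type*} [MeasurableSpace Z]
    {F : Z → Mod L}
    (hf : ∀ (n : ℕ) (f : L.Functions n) v w, MeasurableSet {z | (F z).funMap f v = w})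
    (hr : ∀ (n : ℕ) (R : L.Relations n) v, MeasurableSet {z | (F z).RelMap R v}) :
    Measurable F := by
  refine measurable_comap_iff.2 (Measurable.prodMk ?_ ?_)
  · exact measurable_pi_lambda _ fun p => measurable_to_countable' fun w => hf _ p.2.1 p.2.2 w
  · exact measurable_pi_lambda _ fun p => measurableSet_setOfPred.1 (hr _ p.2.1 p.2.2)

/-- The language is relational, so every term is a variable and atomic formulas give basic
measurable sets; countable conjunctions and quantifiers over ℕ are countable intersections. -/
theorem InfFormula.measurableSet_realize {n : ℕ} (φ : InfFormula orderedGraphLang n)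
    (v : Fin n → ℕ) :
    MeasurableSet {x : Mod orderedGraphLang | @InfFormula.Realize _ ℕ x n φ v} := by
  have hterm : ∀ {n : ℕ} (t : orderedGraphLang.Term (Fin n)), ∃ i, t = .var i := by
    intro n t
    cases t with
    | var i => exact ⟨i, rfl⟩
    | func f _ => exact f.elim
  induction φ with
  | falsum => simp [InfFormula.Realize]
  | equal s t =>
    obtain ⟨i, rfl⟩ := hterm s
    obtain ⟨j, rfl⟩ := hterm t
    simp [InfFormula.Realize]
  | rel R ts =>
    choose i hi using fun k => hterm (ts k)
    simp only [InfFormula.Realize, hi]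
    exact Mod.measurableSet_relMap R fun k => v (i k)
  | imp φ ψ h₁ h₂ =>
    simp only [InfFormula.Realize, imp_iff_not_or]
    exact (h₁ v).compl.union (h₂ v)
  | conj φ h =>
    simp only [InfFormula.Realize, Set.ofPred_forall]
    exact MeasurableSet.iInter fun i => h i v
  | all φ h =>
    simp only [InfFormula.Realize, Set.ofPred_forall]
    exact MeasurableSet.iInter fun a => h _

theorem Definable.measurableSet {n : ℕ} {P : Mod orderedGraphLang → (Fin n → ℕ) → Prop}
    (h : Definable n P) (v : Fin n → ℕ) : MeasurableSet {x | P x v} := by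
  obtain ⟨φ, hφ⟩ := h
  simpa only [hφ] using φ.measurableSet_realize v

theorem Definable.isElementaryClass {L : FirstOrder.Language.{0, 0}}
    {P : Mod L → (Fin 0 → ℕ) → Prop} (h : Definable 0 P) :
    IsElementaryClass {x | P x Fin.elim0} := by
  obtain ⟨φ, hφ⟩ := h
  exact ⟨φ, by ext x; exact (hφ x _).symm⟩

end BorelClass

/-! ### The coding forest of a family of relations. -/

namespace BorelClass

/-- The kinds of nodes, up to parameters, of the forest coding a relational structure whose
relations are indexed by `I`: nodes of a fixed universal chain, elements of the structure, and
nodes of the chain attached to an atomic formula. -/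
inductive Shape (I : Type) : Type
  | top (k : ℕ) : Shape I
  | elt : Shape I
  | chain (s : I) (p : ℕ) : Shape I

instance {I : Type} [Countable I] : Countable (Shape I) := by
  let f : Shape I → ℕ ⊕ Unit ⊕ I × ℕ
    | .top k => .inl k
    | .elt => .inr (.inl ())
    | .chain s p => .inr (.inr (s, p))
  refine Function.Injective.countable (f := f) ?_
  rintro (_ | _ | _) (_ | _ | _) h <;> simp_all [f]

variable {I : Type} {ar : I → ℕ} {idx : I → ℕ}

/-- The number of elements of the structure on which a node of a given shape depends. -/
def Shape.arity (ar : I → ℕ) : Shape I → ℕ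
  | .top _ => 0
  | .elt => 1
  | .chain s _ => ar s

/-- A family of relations on `ℕ` with the given arities. -/
abbrev RelFamily (ar : I → ℕ) : Type := ∀ s : I, (Fin (ar s) → ℕ) → Prop

/-- Isomorphism of families of relations. -/
def RelFamily.Iso (c c' : RelFamily ar) : Prop :=
  ∃ π : ℕ ≃ ℕ, ∀ s v, c s v ↔ c' s (π ∘ v)

/-- The first relation of the coding forest: distinct chains are incomparable. -/
def CoreEdge (ar : I → ℕ) : (σ : Shape I) → (Fin (σ.arity ar) → ℕ) →
    (τ : Shape I) → (Fin (τ.arity ar) → ℕ) → Prop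
  | .top k, _, .top l, _ => k < l
  | .chain s p, v, .chain t q, w => s = t ∧ v ≍ w ∧ p < q
  | _, _, _, _ => False

/-- The second relation of the coding forest. It is total on the universal chain and reflexive on
elements. The `p`-th node of the chain of an atomic formula is related to the `p`-th argument; it is
related to itself at the height `2 * idx s`, which encodes the relation symbol `s`, and at the
height `2 * idx s + 1` if the formula is true. -/
def CoreOrder (idx : I → ℕ) (c : RelFamily ar) : (σ : Shape I) → (Fin (σ.arity ar) → ℕ) →
    (τ : Shape I) → (Fin (τ.arity ar) → ℕ) → Prop
  | .top _, _, .top _, _ => True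
  | .elt, v, .elt, w => v (0 : Fin 1) = w (0 : Fin 1)
  | .chain s p, v, .elt, w => ∃ j : Fin (ar s), p = j ∧ v j = w (0 : Fin 1)
  | .chain s p, v, .chain t q, w =>
    s = t ∧ v ≍ w ∧ p = q ∧ (p = 2 * idx s ∨ p = 2 * idx s + 1 ∧ c s v)
  | _, _, _, _ => False

/-- The nodes of the coding forest: isolated nodes, and nodes of the different shapes. -/
abbrev Node (ar : I → ℕ) : Type := ℕ ⊕ Σ σ : Shape I, (Fin (σ.arity ar) → ℕ)

/-- The first relation on all nodes. -/
def NodeEdge (ar : I → ℕ) : Node ar → Node ar → Prop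
  | .inr a, .inr b => CoreEdge ar a.1 a.2 b.1 b.2
  | _, _ => False

/-- The second relation on all nodes. -/
def NodeOrder (idx : I → ℕ) (c : RelFamily ar) : Node ar → Node ar → Prop
  | .inr a, .inr b => CoreOrder idx c a.1 a.2 b.1 b.2
  | _, _ => False

/-- The height of a node. -/
def nodeHeight : Node ar → ℕ
  | .inr ⟨.top k, _⟩ => k
  | .inr ⟨.chain _ p, _⟩ => p
  | _ => 0

/-- The node of an element. -/
def eltNode (ar : I → ℕ) (m : ℕ) : Node ar := .inr ⟨.elt, fun _ => m⟩

/-- The node of the universal chain at a given height. -/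
def topNode (ar : I → ℕ) (k : ℕ) : Node ar := .inr ⟨.top k, fun i => i.elim0⟩

/-- A node of the chain of an atomic formula. -/
def chainNode (ar : I → ℕ) (s : I) (v : Fin (ar s) → ℕ) (p : ℕ) : Node ar := .inr ⟨.chain s p, v⟩

/-- Case analysis in which the empty tuple of a `top` node and the one-entry tuple of an `elt` node
are put in canonical form, so that the simp lemmas below apply. -/
theorem Node.cases {C : Node ar → Prop} (iso : ∀ k, C (.inl k)) (top : ∀ k, C (topNode ar k))
    (elt : ∀ m, C (eltNode ar m)) (chain : ∀ s v p, C (chainNode ar s v p)) (a : Node ar) : C a := by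
  rcases a with k | ⟨k | _ | ⟨s, p⟩, v⟩
  · exact iso k
  · obtain rfl : v = fun i => i.elim0 := funext fun i => Fin.elim0 i
    exact top k
  · have hv : v = fun _ => v (0 : Fin 1) :=
      funext fun i => congrArg v (Subsingleton.elim (α := Fin 1) _ _)
    rw [hv]
    exact elt (v (0 : Fin 1))
  · exact chain s v p

section simpLemmas

variable (c : RelFamily ar) (a : Node ar) (k l m m' p q : ℕ) (s t : I) (v : Fin (ar s) → ℕ)
  (w : Fin (ar t) → ℕ)

@[simp] theorem inl_ne_top : (.inl k : Node ar) ≠ topNode ar l := by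
  rintro ⟨⟩
@[simp] theorem topNode_ne_elt : topNode ar k ≠ eltNode ar m := by
  rintro ⟨⟩
@[simp] theorem topNode_ne_chain : topNode ar k ≠ chainNode ar s v p := by
  rintro ⟨⟩
@[simp] theorem inl_ne_elt : (.inl k : Node ar) ≠ eltNode ar m := by
  rintro ⟨⟩
@[simp] theorem eltNode_ne_top : eltNode ar m ≠ topNode ar k := by
  rintro ⟨⟩
@[simp] theorem eltNode_ne_chain : eltNode ar m ≠ chainNode ar s v p := by
  rintro ⟨⟩
@[simp] theorem inl_ne_chain : (.inl k : Node ar) ≠ chainNode ar s v p := by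
  rintro ⟨⟩
@[simp] theorem chainNode_ne_inl : chainNode ar s v p ≠ .inl k := by
  rintro ⟨⟩
@[simp] theorem chainNode_ne_top : chainNode ar s v p ≠ topNode ar k := by
  rintro ⟨⟩
@[simp] theorem chainNode_ne_elt : chainNode ar s v p ≠ eltNode ar m := by
  rintro ⟨⟩
@[simp] theorem topNode_inj :
    topNode ar k = topNode ar l ↔ k = l := by
  exact ⟨by rintro ⟨⟩; rfl, by rintro rfl; rfl⟩
@[simp] theorem eltNode_inj :
    eltNode ar m = eltNode ar m' ↔ m = m' := by
  refine ⟨fun h => ?_, by rintro rfl; rfl⟩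
  have h' := Sum.inr_injective h
  rw [Sigma.mk.injEq] at h'
  exact congrFun (eq_of_heq h'.2) (0 : Fin 1)
@[simp] theorem chainNode_inj :
    chainNode ar s v p = chainNode ar t w q ↔ s = t ∧ v ≍ w ∧ p = q := by
  exact ⟨by rintro ⟨⟩; simp, by rintro ⟨rfl, h, rfl⟩; cases h; rfl⟩
@[simp] theorem nodeEdge_inl_left : NodeEdge ar (.inl k) a ↔ False := by simp [NodeEdge]
@[simp] theorem nodeEdge_inl_right : NodeEdge ar a (.inl k) ↔ False := by simp [NodeEdge]
@[simp] theorem nodeEdge_elt_left : NodeEdge ar (eltNode ar m) a ↔ False := by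
  rcases a with k | ⟨_, _⟩ <;> simp [NodeEdge, CoreEdge, eltNode]
@[simp] theorem nodeEdge_elt_right : NodeEdge ar a (eltNode ar m) ↔ False := by
  rcases a with k | ⟨_ | _ | _, _⟩ <;> simp [NodeEdge, CoreEdge, eltNode]
@[simp] theorem nodeEdge_top_top : NodeEdge ar (topNode ar k) (topNode ar l) ↔ k < l := Iff.rfl
@[simp] theorem nodeEdge_top_chain : NodeEdge ar (topNode ar k) (chainNode ar s v p) ↔ False :=
  Iff.rfl
@[simp] theorem nodeEdge_chain_top : NodeEdge ar (chainNode ar s v p) (topNode ar k) ↔ False :=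
  Iff.rfl
@[simp] theorem nodeEdge_chain_chain : NodeEdge ar (chainNode ar s v p) (chainNode ar t w q) ↔
    s = t ∧ v ≍ w ∧ p < q := Iff.rfl
@[simp] theorem nodeOrder_inl_left : NodeOrder idx c (.inl k) a ↔ False := by simp [NodeOrder]
@[simp] theorem nodeOrder_inl_right : NodeOrder idx c a (.inl k) ↔ False := by simp [NodeOrder]
@[simp] theorem nodeOrder_top_top : NodeOrder idx c (topNode ar k) (topNode ar l) ↔ True := Iff.rfl
@[simp] theorem nodeOrder_top_elt : NodeOrder idx c (topNode ar k) (eltNode ar m) ↔ False :=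
  Iff.rfl
@[simp] theorem nodeOrder_top_chain :
    NodeOrder idx c (topNode ar k) (chainNode ar s v p) ↔ False :=
  Iff.rfl
@[simp] theorem nodeOrder_elt_top : NodeOrder idx c (eltNode ar m) (topNode ar k) ↔ False :=
  Iff.rfl
@[simp] theorem nodeOrder_elt_elt : NodeOrder idx c (eltNode ar m) (eltNode ar m') ↔ m = m' :=
  Iff.rfl
@[simp] theorem nodeOrder_elt_chain :
    NodeOrder idx c (eltNode ar m) (chainNode ar s v p) ↔ False :=
  Iff.rfl
@[simp] theorem nodeOrder_chain_top :
    NodeOrder idx c (chainNode ar s v p) (topNode ar k) ↔ False :=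
  Iff.rfl
@[simp] theorem nodeOrder_chain_elt : NodeOrder idx c (chainNode ar s v p) (eltNode ar m) ↔
    ∃ j : Fin (ar s), p = j ∧ v j = m := Iff.rfl
@[simp] theorem nodeOrder_chain_chain :
    NodeOrder idx c (chainNode ar s v p) (chainNode ar t w q) ↔
      s = t ∧ v ≍ w ∧ p = q ∧ (p = 2 * idx s ∨ p = 2 * idx s + 1 ∧ c s v) := Iff.rfl
@[simp] theorem nodeHeight_inl : nodeHeight (ar := ar) (.inl k) = 0 := rfl
@[simp] theorem nodeHeight_top : nodeHeight (topNode ar k) = k := rfl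
@[simp] theorem nodeHeight_elt : nodeHeight (eltNode ar m) = 0 := rfl
@[simp] theorem nodeHeight_chain : nodeHeight (chainNode ar s v p) = p := rfl

end simpLemmas

/-- This one monotonicity yields irreflexivity, well-foundedness and the collapse onto the universal
chain. -/
theorem NodeEdge.height_lt {a b : Node ar} (h : NodeEdge ar a b) : nodeHeight a < nodeHeight b := by
  induction a using Node.cases <;> induction b using Node.cases <;> simp_all

theorem NodeEdge.trans {a b d : Node ar} (h : NodeEdge ar a b) (h' : NodeEdge ar b d) :
    NodeEdge ar a d := by
  induction a using Node.cases <;> induction b using Node.cases <;>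
    induction d using Node.cases <;> simp at h h' ⊢ <;> grind

theorem NodeEdge.trichotomous {a b d : Node ar} (h : NodeEdge ar a d) (h' : NodeEdge ar b d) :
    NodeEdge ar a b ∨ a = b ∨ NodeEdge ar b a := by
  induction a using Node.cases <;> induction b using Node.cases <;>
    induction d using Node.cases <;> simp at h h' ⊢ <;> grind

/-- Chains skip no height, so `nodeHeight` agrees with the height that formulas can express. -/
theorem NodeEdge.exists_height {b : Node ar} {q : ℕ} (h : q < nodeHeight b) :
    ∃ a, NodeEdge ar a b ∧ nodeHeight a = q := by
  induction b using Node.cases with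
  | iso => simp at h
  | elt => simp at h
  | top k => exact ⟨topNode ar q, by simpa using h⟩
  | chain s v p => exact ⟨chainNode ar s v q, by simpa using h⟩

/-- Off the universal chain a related pair is a loop or leads from a chain node to an element node,
and the only pairs starting at an element node are loops; composition creates nothing new. -/
theorem NodeOrder.trans {c : RelFamily ar} {a b d : Node ar} (h : NodeOrder idx c a b)
    (h' : NodeOrder idx c b d) : NodeOrder idx c a d := by
  induction a using Node.cases <;> induction b using Node.cases <;>
    induction d using Node.cases <;> simp at h h' ⊢ <;>
    first
    | (obtain ⟨rfl, h, rfl, -⟩ := h; cases h; exact h')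
    | grind

/-- `Coding idx y c` is an isomorphism of the coding forest of `c` with `y`. -/
structure Coding (idx : I → ℕ) (y : Mod orderedGraphLang) (c : RelFamily ar) where
  toEquiv : Node ar ≃ ℕ
  edge_iff : ∀ a b, y.edge (toEquiv a) (toEquiv b) ↔ NodeEdge ar a b
  order_iff : ∀ a b, y.order (toEquiv a) (toEquiv b) ↔ NodeOrder idx c a b

/-- An isomorphism of ordered graphs, in terms of the two relations. -/
theorem orderedGraph_iso_of {x y : Mod orderedGraphLang} (g : ℕ ≃ ℕ)
    (he : ∀ a b, y.edge (g a) (g b) ↔ x.edge a b)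
    (ho : ∀ a b, y.order (g a) (g b) ↔ x.order a b) : Mod.Iso x y := by
  refine ⟨@FirstOrder.Language.Equiv.mk _ _ _ x y g (fun f => f.elim) ?_⟩
  intro n R v
  have hv : n = 2 := by cases R <;> rfl
  subst hv
  have h₁ : v = ![v 0, v 1] := by funext i; fin_cases i <;> rfl
  have h₂ : (g : ℕ → ℕ) ∘ v = ![g (v 0), g (v 1)] := by funext i; fin_cases i <;> rfl
  cases R with
  | edge => have := he (v 0) (v 1); unfold Mod.edge at this; rw [← h₁, ← h₂] at this; exact this
  | order => have := ho (v 0) (v 1); unfold Mod.order at this; rw [← h₁, ← h₂] at this; exact this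

theorem orderedGraph_weakEpiLE_of {x y : Mod orderedGraphLang} (g : ℕ → ℕ)
    (hg : Function.Surjective g) (he : ∀ a b, y.edge a b → x.edge (g a) (g b))
    (ho : ∀ a b, y.order a b → x.order (g a) (g b)) : Mod.WeakEpiLE x y := by
  refine ⟨@FirstOrder.Language.Hom.mk _ _ _ y x g (fun f => f.elim) ?_, hg⟩
  intro n R v
  have hv : n = 2 := by cases R <;> rfl
  subst hv
  have h₁ : v = ![v 0, v 1] := by funext i; fin_cases i <;> rfl
  have h₂ : (g : ℕ → ℕ) ∘ v = ![g (v 0), g (v 1)] := by funext i; fin_cases i <;> rfl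
  cases R with
  | edge => have := he (v 0) (v 1); unfold Mod.edge at this; rw [← h₁, ← h₂] at this; exact this
  | order => have := ho (v 0) (v 1); unfold Mod.order at this; rw [← h₁, ← h₂] at this; exact this

theorem orderedGraph_iso_iff {x y : Mod orderedGraphLang} (h : Mod.Iso x y) :
    ∃ g : ℕ ≃ ℕ, (∀ a b, y.edge (g a) (g b) ↔ x.edge a b) ∧
      ∀ a b, y.order (g a) (g b) ↔ x.order a b := by
  obtain ⟨g⟩ := h
  have h : ∀ (f : ℕ → ℕ) a b, ![f a, f b] = f ∘ ![a, b] := by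
    intro f a b
    funext k
    fin_cases k <;> rfl
  exact ⟨@FirstOrder.Language.Equiv.toEquiv _ _ _ x y g,
    fun a b => Iff.trans (iff_of_eq (congrArg (y.RelMap (n := 2) OrderedGraphRel.edge) (h _ a b)))
      (@FirstOrder.Language.Equiv.map_rel' _ _ _ x y g 2 OrderedGraphRel.edge ![a, b]),
    fun a b => Iff.trans (iff_of_eq (congrArg (y.RelMap (n := 2) OrderedGraphRel.order) (h _ a b)))
      (@FirstOrder.Language.Equiv.map_rel' _ _ _ x y g 2 OrderedGraphRel.order ![a, b])⟩

namespace Coding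

variable {c c' : RelFamily ar} {y y' : Mod orderedGraphLang}

theorem isOrderedTree (g : Coding idx y c) : IsOrderedTree y := by
  have key : ∀ a b, y.edge a b ↔ NodeEdge ar (g.toEquiv.symm a) (g.toEquiv.symm b) :=
    fun a b => by simp [← g.edge_iff]
  have key' : ∀ a b, y.order a b ↔ NodeOrder idx c (g.toEquiv.symm a) (g.toEquiv.symm b) :=
    fun a b => by simp [← g.order_iff]
  refine ⟨?_, fun t => ?_, fun a b d => ?_⟩
  · exact
      { irrefl := fun a h => ((key a a).1 h).height_lt.false
        trans := fun a b d h h' => (key a d).2 (((key a b).1 h).trans ((key b d).1 h')) }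
  · refine @IsWellOrder.mk _ _ ⟨?_⟩ ⟨fun a b h₁ h₂ => ?_⟩
    · exact Subrelation.wf (fun {a b} h => ((key _ _).1 h).height_lt)
        (InvImage.wf (fun a : {s // y.edge s t} => nodeHeight (g.toEquiv.symm a.1)) wellFounded_lt)
    · rcases ((key _ _).1 a.2).trichotomous ((key _ _).1 b.2) with h | h | h
      · exact (h₁ ((key _ _).2 h)).elim
      · exact Subtype.ext (g.toEquiv.symm.injective h)
      · exact (h₂ ((key _ _).2 h)).elim
  · rw [key', key', key']
    exact NodeOrder.trans

/-- Isolated nodes alone already cover the target. All other nodes go to the universal chain at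
their own height: edges survive since they increase height, and the second relation survives since
it is total there. -/
theorem weakEpiLE (g : Coding idx y c) (g' : Coding idx y' c') : Mod.WeakEpiLE y y' := by
  let f : Node ar → ℕ
    | .inl k => k
    | .inr a => g.toEquiv (topNode ar (nodeHeight (.inr a)))
  refine orderedGraph_weakEpiLE_of (fun a => f (g'.toEquiv.symm a))
    (fun b => ⟨g'.toEquiv (.inl b), by simp [f]⟩) ?_ ?_
  · refine g'.toEquiv.surjective.forall₂.2 fun a b h => ?_
    rw [g'.edge_iff] at h
    rcases a with a | a <;> rcases b with b | b <;>
      try simp only [nodeEdge_inl_left, nodeEdge_inl_right] at h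
    simpa [f, g.edge_iff] using h.height_lt
  · refine g'.toEquiv.surjective.forall₂.2 fun a b h => ?_
    rw [g'.order_iff] at h
    rcases a with a | a <;> rcases b with b | b <;>
      try simp only [nodeOrder_inl_left, nodeOrder_inl_right] at h
    simp [f, g.order_iff]

theorem iso (g : Coding idx y c) (g' : Coding idx y' c) : Mod.Iso y y' :=
  orderedGraph_iso_of (g.toEquiv.symm.trans g'.toEquiv)
    (fun a b => by simp [g'.edge_iff, ← g.edge_iff])
    (fun a b => by simp [g'.order_iff, ← g.order_iff])

theorem of_iso (g : Coding idx y c) (h : Mod.Iso y y') : Nonempty (Coding idx y' c) := by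
  obtain ⟨f, he, ho⟩ := orderedGraph_iso_iff h
  exact ⟨⟨g.toEquiv.trans f, by simp [he, g.edge_iff], by simp [ho, g.order_iff]⟩⟩

end Coding

theorem comp_heq_comp_iff {g : ℕ → ℕ} (hg : g.Injective) {s t : I} (h : s = t)
    (v : Fin (ar s) → ℕ) (w : Fin (ar t) → ℕ) : g ∘ v ≍ g ∘ w ↔ v ≍ w := by
  subst h
  rw [heq_eq_eq, heq_eq_eq, hg.comp_left.eq_iff]

theorem CoreEdge.comp_iff {g : ℕ → ℕ} (hg : g.Injective) (σ τ : Shape I)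
    (v : Fin (σ.arity ar) → ℕ) (w : Fin (τ.arity ar) → ℕ) :
    CoreEdge ar σ (g ∘ v) τ (g ∘ w) ↔ CoreEdge ar σ v τ w := by
  rcases σ with _ | _ | ⟨s, p⟩ <;> rcases τ with _ | _ | ⟨t, q⟩ <;> try exact Iff.rfl
  exact and_congr_right fun h => and_congr_left' (comp_heq_comp_iff hg h v w)

/-- Parameters enter only through equalities and through `c`, so injectivity suffices. Surjectivity
is not available when ℕ is embedded onto the set of element nodes. -/
theorem CoreOrder.comp_iff {c c' : RelFamily ar} {g : ℕ → ℕ} (hg : g.Injective)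
    (hc : ∀ s v, c' s (g ∘ v) ↔ c s v) (σ τ : Shape I)
    (v : Fin (σ.arity ar) → ℕ) (w : Fin (τ.arity ar) → ℕ) :
    CoreOrder idx c' σ (g ∘ v) τ (g ∘ w) ↔ CoreOrder idx c σ v τ w := by
  rcases σ with _ | _ | ⟨s, p⟩ <;> rcases τ with _ | _ | ⟨t, q⟩ <;> try exact Iff.rfl
  · exact hg.eq_iff
  · exact exists_congr fun j => and_congr_right' hg.eq_iff
  · exact and_congr_right fun h => and_congr (comp_heq_comp_iff hg h v w)
      (and_congr_right' (or_congr_right (and_congr_right' (hc s v))))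

theorem Coding.of_family_iso {c c' : RelFamily ar} {y : Mod orderedGraphLang}
    (g : Coding idx y c') (h : c.Iso c') : Nonempty (Coding idx y c) := by
  obtain ⟨π, hπ⟩ := h
  let f : Node ar ≃ Node ar :=
    Equiv.sumCongr (Equiv.refl ℕ) (Equiv.sigmaCongrRight fun _ => Equiv.arrowCongr (Equiv.refl _) π)
  have hf : ∀ a, f (.inr a) = .inr ⟨a.1, π ∘ a.2⟩ := fun _ => rfl
  have hf' : ∀ k, f (.inl k) = .inl k := fun _ => rfl
  refine ⟨⟨f.trans g.toEquiv, fun a b => ?_, fun a b => ?_⟩⟩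
  · rw [Equiv.trans_apply, Equiv.trans_apply, g.edge_iff]
    rcases a with a | a <;> rcases b with b | b <;>
      simp only [hf, hf', nodeEdge_inl_left, nodeEdge_inl_right]
    exact CoreEdge.comp_iff π.injective _ _ _ _
  · rw [Equiv.trans_apply, Equiv.trans_apply, g.order_iff]
    rcases a with a | a <;> rcases b with b | b <;>
      simp only [hf, hf', nodeOrder_inl_left, nodeOrder_inl_right]
    exact CoreOrder.comp_iff π.injective (fun s v => (hπ s v).symm) _ _ _ _

end BorelClass

/-! ### Reading the coded structure off the forest by formulas. -/

namespace BorelClass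

variable {I : Type} {ar : I → ℕ} {idx : I → ℕ}

section Predicates

variable (y : Mod orderedGraphLang)

/-- `a` has height at least `p`. -/
def HeightGE : ℕ → ℕ → Prop
  | 0, _ => True
  | p + 1, a => ∃ b, y.edge b a ∧ HeightGE p b

/-- `a` has height `p`. -/
def HasHeight (p a : ℕ) : Prop := HeightGE y p a ∧ ¬ HeightGE y (p + 1) a

/-- `a` is an element of the coded structure. -/
def IsElt (a : ℕ) : Prop := y.order a a ∧ ¬ ∃ b, y.edge a b

/-- `a` is isolated. -/
def IsIsolated (a : ℕ) : Prop :=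
  ∀ b, ¬ y.edge a b ∧ ¬ y.edge b a ∧ ¬ y.order a b ∧ ¬ y.order b a

/-- `a` lies on the universal chain. -/
def IsTop (a : ℕ) : Prop := ∃ b, y.edge a b ∧ y.order a b

/-- The chain of `a` has a node of height `p` which is related to `m`. -/
def ChainRel (a p m : ℕ) : Prop :=
  ∃ b, (a = b ∨ y.edge a b ∨ y.edge b a) ∧ HasHeight y p b ∧ y.order b m

/-- The chain of `a` has a node of height `p` which is related to itself. -/
def ChainFlag (a p : ℕ) : Prop :=
  ∃ b, (a = b ∨ y.edge a b ∨ y.edge b a) ∧ HasHeight y p b ∧ y.order b b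

/-- `a` is the node of shape `σ` with parameters `v`. -/
def Denotes (idx : I → ℕ) : (σ : Shape I) → ℕ → (Fin (σ.arity ar) → ℕ) → Prop
  | .top k, a, _ => IsTop y a ∧ HasHeight y k a
  | .elt, a, v => a = v (0 : Fin 1)
  | .chain s p, a, v => ((¬ IsTop y a ∧ ∃ b, y.edge a b) ∧ HasHeight y p a) ∧
      ChainFlag y a (2 * idx s) ∧ ∀ j : Fin (ar s), ChainRel y a j (v j)

/-- The relations of the coded structure. -/
def Holds (idx : I → ℕ) : RelFamily ar := fun s v =>
  ∃ a, Denotes (ar := ar) y idx (.chain s (2 * idx s + 1)) a v ∧ y.order a a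

/-- `y` is isomorphic to the coding forest of a relational structure. -/
structure IsCoded (ar : I → ℕ) (idx : I → ℕ) : Prop where
  infinite_isolated : ∀ n : ℕ, ∀ v : Fin n → ℕ, ∃ a, IsIsolated y a ∧ ∀ j, ¬ a = v j
  infinite_elt : ∀ n : ℕ, ∀ v : Fin n → ℕ, ∃ a, IsElt y a ∧ ∀ j, ¬ a = v j
  exists_denotes : ∀ (σ : Shape I) (v : Fin (σ.arity ar) → ℕ), (∀ j, IsElt y (v j)) →
    ∃ a, Denotes y idx σ a v
  denotes_unique : ∀ (σ : Shape I) (v : Fin (σ.arity ar) → ℕ), (∀ j, IsElt y (v j)) →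
    ∀ a b, Denotes y idx σ a v → Denotes y idx σ b v → a = b
  denotes_inj : ∀ (σ τ : Shape I) (v : Fin (σ.arity ar) → ℕ) (w : Fin (τ.arity ar) → ℕ),
    (∀ j, IsElt y (v j)) → (∀ j, IsElt y (w j)) →
    ∀ a, Denotes y idx σ a v → Denotes y idx τ a w → σ = τ ∧ v ≍ w
  covered : ∀ a, IsIsolated y a ∨
    ∃ σ : Shape I, ∃ v : Fin (σ.arity ar) → ℕ, (∀ j, IsElt y (v j)) ∧ Denotes y idx σ a v
  not_isolated : ∀ (σ : Shape I) (v : Fin (σ.arity ar) → ℕ), (∀ j, IsElt y (v j)) →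
    ∀ a, Denotes y idx σ a v → ¬ IsIsolated y a
  edge_iff : ∀ (σ τ : Shape I) (v : Fin (σ.arity ar) → ℕ) (w : Fin (τ.arity ar) → ℕ),
    (∀ j, IsElt y (v j)) → (∀ j, IsElt y (w j)) →
    ∀ a b, Denotes y idx σ a v → Denotes y idx τ b w → (y.edge a b ↔ CoreEdge ar σ v τ w)
  order_iff : ∀ (σ τ : Shape I) (v : Fin (σ.arity ar) → ℕ) (w : Fin (τ.arity ar) → ℕ),
    (∀ j, IsElt y (v j)) → (∀ j, IsElt y (w j)) →
    ∀ a b, Denotes y idx σ a v → Denotes y idx τ b w →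
      (y.order a b ↔ CoreOrder idx (Holds y idx) σ v τ w)

/-- The relational structure coded by `y`, transported to `ℕ` by enumerating its elements. -/
def decode (idx : I → ℕ) : RelFamily ar := fun s v => Holds y idx s (Nat.nth (IsElt y) ∘ v)

end Predicates

section Definability

variable {n : ℕ}

open Definable

theorem definable_heightGE (p : ℕ) : ∀ {n : ℕ} (i : Fin n),
    Definable n (fun y u => HeightGE y p (u i)) := by
  induction p with
  | zero => exact fun i => const True
  | succ p ih => exact fun i => ex ((Definable.edge _ _).and (ih _))

theorem definable_hasHeight (p : ℕ) (i : Fin n) : Definable n (fun y u => HasHeight y p (u i)) :=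
  (definable_heightGE p i).and (definable_heightGE (p + 1) i).not

theorem definable_isElt (i : Fin n) : Definable n (fun y u => IsElt y (u i)) :=
  (Definable.order i i).and (ex (Definable.edge _ _)).not

theorem definable_isIsolated (i : Fin n) : Definable n (fun y u => IsIsolated y (u i)) :=
  all ((Definable.edge _ _).not.and
    ((Definable.edge _ _).not.and ((Definable.order _ _).not.and (Definable.order _ _).not)))

theorem definable_isTop (i : Fin n) : Definable n (fun y u => IsTop y (u i)) :=
  ex ((Definable.edge _ _).and (Definable.order _ _))

theorem definable_chainRel (p : ℕ) (i j : Fin n) :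
    Definable n (fun y u => ChainRel y (u i) p (u j)) :=
  ex (((Definable.eq _ _).or ((Definable.edge _ _).or (Definable.edge _ _))).and
    ((definable_hasHeight p _).and (Definable.order _ _)))

theorem definable_chainFlag (p : ℕ) (i : Fin n) :
    Definable n (fun y u => ChainFlag y (u i) p) :=
  ex (((Definable.eq _ _).or ((Definable.edge _ _).or (Definable.edge _ _))).and
    ((definable_hasHeight p _).and (Definable.order _ _)))

theorem definable_denotes (σ : Shape I) (i : Fin n) (f : Fin (σ.arity ar) → Fin n) :
    Definable n (fun y u => Denotes y idx σ (u i) (fun j => u (f j))) := by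
  rcases σ with k | _ | ⟨s, p⟩
  · exact (definable_isTop i).and (definable_hasHeight k i)
  · exact Definable.eq _ _
  · exact (((definable_isTop i).not.and (ex (Definable.edge _ _))).and
      (definable_hasHeight p i)).and
        ((definable_chainFlag _ i).and (iAll fun j => definable_chainRel j i (f j)))

theorem definable_holds (s : I) (f : Fin (ar s) → Fin n) :
    Definable n (fun y u => Holds y idx s (fun j => u (f j))) :=
  ex ((definable_denotes (.chain s (2 * idx s + 1)) (Fin.last n) fun j => (f j).castSucc).and
    (Definable.order _ _))

/-- Whether `s = t` is decided outside the formula: the defining formula is a finite conjunction of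
equalities, or falsum. -/
theorem definable_heq {L : FirstOrder.Language.{0, 0}} {s t : I} (f : Fin (ar s) → Fin n)
    (g : Fin (ar t) → Fin n) : Definable n (fun (_ : Mod L) u =>
      s = t ∧ (fun j => u (f j)) ≍ (fun j => u (g j))) := by
  by_cases h : s = t
  · subst h
    refine (iAll fun j => Definable.eq (f j) (g j)).congr fun y u => ?_
    simp [funext_iff]
  · exact (const False).congr fun y u => by simp [h]

theorem definable_coreEdge (σ τ : Shape I) (f : Fin (σ.arity ar) → Fin n)
    (g : Fin (τ.arity ar) → Fin n) : Definable n (fun (_ : Mod orderedGraphLang) u =>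
      CoreEdge ar σ (fun j => u (f j)) τ (fun j => u (g j))) := by
  rcases σ with k | _ | ⟨s, p⟩ <;> rcases τ with l | _ | ⟨t, q⟩ <;> try exact const _
  exact ((definable_heq (ar := ar) (s := s) (t := t) f g).and (const (p < q))).congr fun y u => and_assoc

theorem definable_coreOrder (σ τ : Shape I) (f : Fin (σ.arity ar) → Fin n)
    (g : Fin (τ.arity ar) → Fin n) : Definable n (fun y u =>
      CoreOrder idx (Holds y idx) σ (fun j => u (f j)) τ (fun j => u (g j))) := by
  rcases σ with k | _ | ⟨s, p⟩ <;> rcases τ with l | _ | ⟨t, q⟩ <;> try exact const _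
  · exact Definable.eq _ _
  · exact iEx fun j => (const _).and (Definable.eq _ _)
  · exact ((definable_heq (ar := ar) (s := s) (t := t) f g).and ((const (p = q)).and ((const (p = 2 * idx s)).or
      ((const (p = 2 * idx s + 1)).and (definable_holds s f))))).congr fun y u => and_assoc

/-- There are countably many shapes, and each has finitely many parameters, so every clause is a
countable conjunction of formulas. Infinitude is expressed by asking for a new point outside each
finite tuple. -/
theorem definable_isCoded [Countable I] (ar : I → ℕ) (idx : I → ℕ) :
    Definable n (fun y _ => IsCoded y ar idx) := by
  have elts : ∀ {m k : ℕ} (f : Fin k → Fin m), Definable m (fun y u => ∀ j, IsElt y (u (f j))) :=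
    fun f => iAll fun j => definable_isElt (f j)
  have h₁ : Definable n (fun y _ =>
      ∀ k : ℕ, ∀ v : Fin k → ℕ, ∃ a, IsIsolated y a ∧ ∀ j, ¬ a = v j) :=
    iAll fun k => allTuple (ex ((definable_isIsolated _).and (iAll fun j => (Definable.eq _ _).not)))
  have h₂ : Definable n (fun y _ =>
      ∀ k : ℕ, ∀ v : Fin k → ℕ, ∃ a, IsElt y a ∧ ∀ j, ¬ a = v j) :=
    iAll fun k => allTuple (ex ((definable_isElt _).and (iAll fun j => (Definable.eq _ _).not)))
  have h₃ : Definable n (fun y _ => ∀ (σ : Shape I) (v : Fin (σ.arity ar) → ℕ),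
      (∀ j, IsElt y (v j)) → ∃ a, Denotes y idx σ a v) :=
    iAll fun σ => allTuple ((elts _).imp (ex (definable_denotes _ _ _)))
  have h₄ : Definable n (fun y _ => ∀ (σ : Shape I) (v : Fin (σ.arity ar) → ℕ),
      (∀ j, IsElt y (v j)) → ∀ a b, Denotes y idx σ a v → Denotes y idx σ b v → a = b) :=
    iAll fun σ => allTuple ((elts _).imp (all (all ((definable_denotes _ _ _).imp
      ((definable_denotes _ _ _).imp (Definable.eq _ _))))))
  -- The lemma on pairs of a symbol and a tuple is reused with shapes in the role of symbols.
  have heq : ∀ {m} (σ τ : Shape I) (f : Fin (σ.arity ar) → Fin m) (g : Fin (τ.arity ar) → Fin m),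
      Definable m (fun (_ : Mod orderedGraphLang) u =>
        σ = τ ∧ (fun j => u (f j)) ≍ (fun j => u (g j))) :=
    fun σ τ f g => definable_heq (ar := fun σ : Shape I => σ.arity ar) f g
  have h₅ : Definable n (fun y _ => ∀ (σ τ : Shape I) (v : Fin (σ.arity ar) → ℕ)
      (w : Fin (τ.arity ar) → ℕ), (∀ j, IsElt y (v j)) → (∀ j, IsElt y (w j)) →
      ∀ a, Denotes y idx σ a v → Denotes y idx τ a w → σ = τ ∧ v ≍ w) :=
    iAll fun σ => iAll fun τ => allTuple (allTuple ((elts _).imp ((elts _).imp (all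
      ((definable_denotes _ _ _).imp ((definable_denotes _ _ _).imp (heq _ _ _ _)))))))
  have h₆ : Definable n (fun y _ => ∀ a, IsIsolated y a ∨
      ∃ σ : Shape I, ∃ v : Fin (σ.arity ar) → ℕ, (∀ j, IsElt y (v j)) ∧ Denotes y idx σ a v) :=
    all ((definable_isIsolated _).or (iEx fun σ => exTuple ((elts _).and (definable_denotes _ _ _))))
  have h₇ : Definable n (fun y _ => ∀ (σ : Shape I) (v : Fin (σ.arity ar) → ℕ),
      (∀ j, IsElt y (v j)) → ∀ a, Denotes y idx σ a v → ¬ IsIsolated y a) :=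
    iAll fun σ => allTuple ((elts _).imp (all ((definable_denotes _ _ _).imp
      (definable_isIsolated _).not)))
  have h₈ : Definable n (fun y _ => ∀ (σ τ : Shape I) (v : Fin (σ.arity ar) → ℕ)
      (w : Fin (τ.arity ar) → ℕ), (∀ j, IsElt y (v j)) → (∀ j, IsElt y (w j)) →
      ∀ a b, Denotes y idx σ a v → Denotes y idx τ b w →
        (y.edge a b ↔ CoreEdge ar σ v τ w)) :=
    iAll fun σ => iAll fun τ => allTuple (allTuple ((elts _).imp ((elts _).imp (all (all
      ((definable_denotes _ _ _).imp ((definable_denotes _ _ _).imp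
        ((Definable.edge _ _).iff (definable_coreEdge _ _ _ _)))))))))
  have h₉ : Definable n (fun y _ => ∀ (σ τ : Shape I) (v : Fin (σ.arity ar) → ℕ)
      (w : Fin (τ.arity ar) → ℕ), (∀ j, IsElt y (v j)) → (∀ j, IsElt y (w j)) →
      ∀ a b, Denotes y idx σ a v → Denotes y idx τ b w →
        (y.order a b ↔ CoreOrder idx (Holds y idx) σ v τ w)) :=
    iAll fun σ => iAll fun τ => allTuple (allTuple ((elts _).imp ((elts _).imp (all (all
      ((definable_denotes _ _ _).imp ((definable_denotes _ _ _).imp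
        ((Definable.order _ _).iff (definable_coreOrder _ _ _ _)))))))))
  exact (h₁.and (h₂.and (h₃.and (h₄.and (h₅.and (h₆.and (h₇.and (h₈.and h₉)))))))).congr
    fun y _ => ⟨fun ⟨a₁, a₂, a₃, a₄, a₅, a₆, a₇, a₈, a₉⟩ => ⟨a₁, a₂, a₃, a₄, a₅, a₆, a₇, a₈, a₉⟩,
      fun ⟨a₁, a₂, a₃, a₄, a₅, a₆, a₇, a₈, a₉⟩ => ⟨a₁, a₂, a₃, a₄, a₅, a₆, a₇, a₈, a₉⟩⟩

end Definability

/-! ### Correctness of the formulas in a coding forest. -/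

namespace Coding

variable {c : RelFamily ar} {y : Mod orderedGraphLang} (g : Coding idx y c)
include g

theorem heightGE_iff (p : ℕ) (a : Node ar) :
    HeightGE y p (g.toEquiv a) ↔ p ≤ nodeHeight a := by
  induction p generalizing a with
  | zero => simp [HeightGE]
  | succ p ih =>
    rw [HeightGE, g.toEquiv.surjective.exists]
    simp only [g.edge_iff, ih]
    refine ⟨fun ⟨b, hb, hp⟩ => hp.trans_lt hb.height_lt, fun h => ?_⟩
    obtain ⟨b, hb, rfl⟩ := NodeEdge.exists_height h
    exact ⟨b, hb, le_rfl⟩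

theorem hasHeight_iff (p : ℕ) (a : Node ar) :
    HasHeight y p (g.toEquiv a) ↔ nodeHeight a = p := by
  rw [HasHeight, g.heightGE_iff, g.heightGE_iff]
  omega

/-- All chains are infinite upwards, so having a successor separates chain nodes from elements and
isolated nodes. -/
theorem exists_edge_iff (a : Node ar) : (∃ b, y.edge (g.toEquiv a) b) ↔
    (∃ k, a = topNode ar k) ∨ ∃ s v p, a = chainNode ar s v p := by
  refine g.toEquiv.surjective.exists.trans ?_
  simp only [g.edge_iff]
  induction a using Node.cases with
  | iso k => simp
  | elt m => simp
  | top k => exact iff_of_true ⟨topNode ar (k + 1), by simp⟩ (.inl ⟨k, rfl⟩)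
  | chain s v p => exact iff_of_true ⟨chainNode ar s v (p + 1), by simp⟩ (.inr ⟨s, v, p, rfl⟩)

theorem isElt_iff (a : Node ar) : IsElt y (g.toEquiv a) ↔ ∃ m, a = eltNode ar m := by
  rw [IsElt, g.exists_edge_iff, g.order_iff]
  induction a using Node.cases with
  | iso k => simp
  | elt m => simp
  | top k => simp
  | chain s v p => exact iff_of_false (fun h => h.2 (.inr ⟨s, v, p, rfl⟩)) (by simp)

/-- On the chain of an atomic formula the second relation has only loops, so a strict successor
related by it exists only on the universal chain. -/
theorem isTop_iff (a : Node ar) : IsTop y (g.toEquiv a) ↔ ∃ k, a = topNode ar k := by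
  rw [IsTop, g.toEquiv.surjective.exists]
  simp only [g.edge_iff, g.order_iff]
  constructor
  · rintro ⟨b, hb, hb'⟩
    induction a using Node.cases <;> induction b using Node.cases <;> simp at hb hb' ⊢
    omega
  · rintro ⟨k, rfl⟩
    exact ⟨topNode ar (k + 1), by simp⟩

theorem isIsolated_iff (a : Node ar) : IsIsolated y (g.toEquiv a) ↔ ∃ k, a = .inl k := by
  constructor
  · intro h
    obtain ⟨h₁, -, h₂, -⟩ := h (g.toEquiv a)
    induction a using Node.cases with
    | iso k => exact ⟨k, rfl⟩
    | top k => simp [g.order_iff] at h₂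
    | elt m => simp [g.order_iff] at h₂
    | chain s v p =>
      -- A chain node need not carry a loop, so the next node of its chain is the witness.
      have := (h (g.toEquiv (chainNode ar s v (p + 1)))).1
      simp [g.edge_iff] at this
  · rintro ⟨k, rfl⟩
    refine g.toEquiv.surjective.forall.2 fun b => ?_
    simp [g.edge_iff, g.order_iff]

theorem comparable_chain_iff (s : I) (v : Fin (ar s) → ℕ) (p : ℕ) (b : Node ar) :
    (g.toEquiv (chainNode ar s v p) = g.toEquiv b ∨ y.edge (g.toEquiv (chainNode ar s v p))
      (g.toEquiv b) ∨ y.edge (g.toEquiv b) (g.toEquiv (chainNode ar s v p))) ↔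
      ∃ q, b = chainNode ar s v q := by
  rw [g.edge_iff, g.edge_iff, g.toEquiv.injective.eq_iff]
  constructor
  · induction b using Node.cases <;> simp
    grind
  · rintro ⟨q, rfl⟩
    simp
    omega

theorem chainRel_iff (s : I) (v : Fin (ar s) → ℕ) (p q m : ℕ) :
    ChainRel y (g.toEquiv (chainNode ar s v p)) q (g.toEquiv (eltNode ar m)) ↔
      ∃ j : Fin (ar s), q = j ∧ v j = m := by
  rw [ChainRel, g.toEquiv.surjective.exists]
  simp only [g.comparable_chain_iff, g.hasHeight_iff, g.order_iff]
  constructor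
  · rintro ⟨_, ⟨q, rfl⟩, rfl, h⟩
    simpa using h
  · exact fun h => ⟨_, ⟨q, rfl⟩, rfl, by simpa using h⟩

theorem chainFlag_iff (s : I) (v : Fin (ar s) → ℕ) (p q : ℕ) :
    ChainFlag y (g.toEquiv (chainNode ar s v p)) q ↔
      q = 2 * idx s ∨ q = 2 * idx s + 1 ∧ c s v := by
  rw [ChainFlag, g.toEquiv.surjective.exists]
  simp only [g.comparable_chain_iff, g.hasHeight_iff, g.order_iff]
  constructor
  · rintro ⟨_, ⟨q, rfl⟩, rfl, h⟩
    simpa using h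
  · exact fun h => ⟨_, ⟨q, rfl⟩, rfl, by simpa using h⟩

/-- The chain of an atomic formula reveals its symbol by the loop at an even height and its
arguments by the links at heights below the arity; the node is then fixed by its own height. -/
theorem denotes_iff (hidx : idx.Injective) (σ : Shape I) (a : Node ar)
    (v : Fin (σ.arity ar) → ℕ) :
    Denotes y idx σ (g.toEquiv a) (fun j => g.toEquiv (eltNode ar (v j))) ↔ a = .inr ⟨σ, v⟩ := by
  rcases σ with k | _ | ⟨s, p⟩
  · simp only [Denotes, g.isTop_iff, g.hasHeight_iff]
    obtain rfl : v = fun i => i.elim0 := funext fun i => Fin.elim0 i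
    exact ⟨by rintro ⟨⟨l, rfl⟩, rfl⟩; rfl, by rintro rfl; exact ⟨⟨k, rfl⟩, rfl⟩⟩
  · have hv : v = fun _ => v (0 : Fin 1) :=
      funext fun i => congrArg v (Subsingleton.elim (α := Fin 1) _ _)
    rw [hv]
    exact g.toEquiv.injective.eq_iff
  · simp only [Denotes, g.isTop_iff, g.hasHeight_iff, g.exists_edge_iff]
    constructor
    · rintro ⟨⟨⟨h₁, h₂⟩, h₃⟩, h₄, h₅⟩
      obtain ⟨t, w, q, rfl⟩ := h₂.resolve_left h₁
      rw [g.chainFlag_iff] at h₄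
      -- The truth flag sits at an odd height, so a loop at height `2 * idx s` can only be the
      -- symbol tag.
      obtain rfl : s = t := hidx (by omega)
      obtain rfl : w = v := by
        funext j
        obtain ⟨i, hi, hi'⟩ := (g.chainRel_iff _ _ _ _ _).1 (h₅ j)
        rw [Fin.ext hi, hi', ← Fin.ext hi]
      rw [nodeHeight_chain] at h₃
      rw [h₃]
      rfl
    · rintro rfl
      refine ⟨⟨⟨?_, .inr ⟨s, v, p, rfl⟩⟩, rfl⟩, ?_, fun j => ?_⟩
      · rintro ⟨k, ⟨⟩⟩
      · exact (g.chainFlag_iff s v p _).2 (.inl rfl)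
      · exact (g.chainRel_iff s v p _ _).2 ⟨j, rfl, rfl⟩

theorem holds_iff (hidx : idx.Injective) (s : I) (v : Fin (ar s) → ℕ) :
    Holds y idx s (fun j => g.toEquiv (eltNode ar (v j))) ↔ c s v := by
  rw [Holds, g.toEquiv.surjective.exists]
  have h := g.denotes_iff hidx (.chain s (2 * idx s + 1))
  constructor
  · rintro ⟨a, ha, ha'⟩
    rw [(h a v).1 ha, g.order_iff] at ha'
    simpa using (nodeOrder_chain_chain _ _ _ _ _ _ _).1 ha'
  · intro hc
    refine ⟨chainNode ar s v (2 * idx s + 1), (h _ v).2 rfl, ?_⟩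
    rw [g.order_iff]
    simpa using hc

theorem exists_eq_of_isElt {ι : Type*} {v : ι → ℕ} (hv : ∀ j, IsElt y (v j)) :
    ∃ w : ι → ℕ, v = fun j => g.toEquiv (eltNode ar (w j)) := by
  have : ∀ j, ∃ m, v j = g.toEquiv (eltNode ar m) := by
    intro j
    obtain ⟨m, hm⟩ := (g.isElt_iff (g.toEquiv.symm (v j))).1 (by simpa using hv j)
    exact ⟨m, by rw [← hm, Equiv.apply_symm_apply]⟩
  choose w hw using this
  exact ⟨w, funext hw⟩

theorem elt_injective : Function.Injective fun m => g.toEquiv (eltNode ar m) := by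
  intro m m' h
  simpa using g.toEquiv.injective h

theorem isCoded (hidx : idx.Injective) : IsCoded y ar idx where
  infinite_isolated n v := by
    obtain ⟨a, ha⟩ := (Set.infinite_range_of_injective
      (g.toEquiv.injective.comp Sum.inl_injective)).exists_notMem_finite (Set.finite_range v)
    obtain ⟨⟨k, rfl⟩, h⟩ := ha
    exact ⟨_, (g.isIsolated_iff _).2 ⟨k, rfl⟩, fun j hj => h ⟨j, hj.symm⟩⟩
  infinite_elt n v := by
    obtain ⟨a, ha⟩ := (Set.infinite_range_of_injective
      g.elt_injective).exists_notMem_finite (Set.finite_range v)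
    obtain ⟨⟨k, rfl⟩, h⟩ := ha
    exact ⟨_, (g.isElt_iff _).2 ⟨k, rfl⟩, fun j hj => h ⟨j, hj.symm⟩⟩
  exists_denotes σ v hv := by
    obtain ⟨v, rfl⟩ := g.exists_eq_of_isElt hv
    exact ⟨_, (g.denotes_iff hidx σ _ v).2 rfl⟩
  denotes_unique σ v hv := by
    obtain ⟨v, rfl⟩ := g.exists_eq_of_isElt hv
    refine g.toEquiv.surjective.forall₂.2 fun a b ha hb => ?_
    rw [(g.denotes_iff hidx σ _ v).1 ha, (g.denotes_iff hidx σ _ v).1 hb]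
  denotes_inj σ τ v w hv hw := by
    obtain ⟨v, rfl⟩ := g.exists_eq_of_isElt hv
    obtain ⟨w, rfl⟩ := g.exists_eq_of_isElt hw
    refine g.toEquiv.surjective.forall.2 fun a ha hb => ?_
    have h := ((g.denotes_iff hidx σ _ v).1 ha).symm.trans ((g.denotes_iff hidx τ _ w).1 hb)
    cases h
    exact ⟨rfl, HEq.rfl⟩
  covered := by
    refine g.toEquiv.surjective.forall.2 fun a => ?_
    rcases a with k | ⟨σ, v⟩
    · exact .inl ((g.isIsolated_iff _).2 ⟨k, rfl⟩)
    · exact .inr ⟨σ, _, fun j => (g.isElt_iff _).2 ⟨v j, rfl⟩, (g.denotes_iff hidx σ _ v).2 rfl⟩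
  not_isolated σ v hv := by
    obtain ⟨v, rfl⟩ := g.exists_eq_of_isElt hv
    refine g.toEquiv.surjective.forall.2 fun a ha => ?_
    rw [(g.denotes_iff hidx σ _ v).1 ha, g.isIsolated_iff]
    simp
  edge_iff σ τ v w hv hw := by
    obtain ⟨v, rfl⟩ := g.exists_eq_of_isElt hv
    obtain ⟨w, rfl⟩ := g.exists_eq_of_isElt hw
    refine g.toEquiv.surjective.forall₂.2 fun a b ha hb => ?_
    rw [(g.denotes_iff hidx σ _ v).1 ha, (g.denotes_iff hidx τ _ w).1 hb, g.edge_iff]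
    exact (CoreEdge.comp_iff g.elt_injective σ τ v w).symm
  order_iff σ τ v w hv hw := by
    obtain ⟨v, rfl⟩ := g.exists_eq_of_isElt hv
    obtain ⟨w, rfl⟩ := g.exists_eq_of_isElt hw
    refine g.toEquiv.surjective.forall₂.2 fun a b ha hb => ?_
    rw [(g.denotes_iff hidx σ _ v).1 ha, (g.denotes_iff hidx τ _ w).1 hb, g.order_iff]
    exact (CoreOrder.comp_iff g.elt_injective (g.holds_iff hidx) σ τ v w).symm

/-- The element nodes and the relations on them are defined from `y` alone, so two codings differ by
a permutation of the elements, which is the required isomorphism. -/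
theorem family_iso (hidx : idx.Injective) {c' : RelFamily ar} (g' : Coding idx y c') :
    c.Iso c' := by
  -- Stated for arbitrary pairs of codings, since it is used in both directions.
  have key : ∀ {d d' : RelFamily ar} (h : Coding idx y d) (h' : Coding idx y d') (m : ℕ),
      ∃ m', h'.toEquiv (eltNode ar m') = h.toEquiv (eltNode ar m) := by
    intro d d' h h' m
    obtain ⟨w, hw⟩ := h'.exists_eq_of_isElt (ι := Unit) (v := fun _ => h.toEquiv (eltNode ar m))
      fun _ => (h.isElt_iff _).2 ⟨m, rfl⟩
    exact ⟨w (), (congrFun hw ()).symm⟩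
  choose π hπ using key g g'
  choose ρ hρ using key g' g
  refine ⟨⟨π, ρ, fun m => g.elt_injective ?_, fun m => g'.elt_injective ?_⟩, fun s v => ?_⟩
  · simp only [hρ, hπ]
  · simp only [hρ, hπ]
  · rw [← g.holds_iff hidx, ← g'.holds_iff hidx]
    simp [hπ]

end Coding

/-! ### Reconstruction of a coding from the axioms. -/

namespace IsCoded

variable {y : Mod orderedGraphLang} (h : IsCoded y ar idx)
include h

theorem infinite_setOf_isElt : (Set.ofPred (IsElt y)).Infinite := by
  intro hfin
  obtain ⟨a, ha, ha'⟩ := h.infinite_elt _ fun i => (hfin.toFinset.equivFin.symm i : ℕ)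
  exact ha' (hfin.toFinset.equivFin ⟨a, hfin.mem_toFinset.2 ha⟩) (by simp)

theorem infinite_setOf_isIsolated : (Set.ofPred (IsIsolated y)).Infinite := by
  intro hfin
  obtain ⟨a, ha, ha'⟩ := h.infinite_isolated _ fun i => (hfin.toFinset.equivFin.symm i : ℕ)
  exact ha' (hfin.toFinset.equivFin ⟨a, hfin.mem_toFinset.2 ha⟩) (by simp)

theorem isElt_nth (m : ℕ) : IsElt y (Nat.nth (IsElt y) m) :=
  Nat.nth_mem_of_infinite h.infinite_setOf_isElt m

theorem exists_nth {a : ℕ} (ha : IsElt y a) : ∃ m, Nat.nth (IsElt y) m = a :=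
  (Nat.range_nth_of_infinite h.infinite_setOf_isElt).ge ha

theorem nth_injective : Function.Injective (Nat.nth (IsElt y)) :=
  Nat.nth_injective h.infinite_setOf_isElt

/-- Enumerating the elements and the isolated nodes, and choosing for each shape and tuple the node
that it denotes, gives a map from the abstract nodes. The clauses of `IsCoded` make it a bijection
and compute both relations. -/
theorem nonempty_coding : Nonempty (Coding idx y (decode y idx : RelFamily ar)) := by
  let e := Nat.nth (IsElt y)
  have he : ∀ {k} (v : Fin k → ℕ) (j), IsElt y ((e ∘ v) j) := fun v j => h.isElt_nth _
  choose d hd using fun (σ : Shape I) (v : Fin (σ.arity ar) → ℕ) =>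
    h.exists_denotes σ (e ∘ v) (he v)
  let f : Node ar → ℕ
    | .inl k => Nat.nth (IsIsolated y) k
    | .inr a => d a.1 a.2
  have hiso : ∀ k, IsIsolated y (Nat.nth (IsIsolated y) k) :=
    Nat.nth_mem_of_infinite h.infinite_setOf_isIsolated
  have hinj : f.Injective := by
    rintro (k | ⟨σ, v⟩) (l | ⟨τ, w⟩) hab
    · exact congrArg _ (Nat.nth_injective h.infinite_setOf_isIsolated hab)
    · have hab' : Nat.nth (IsIsolated y) k = d τ w := hab
      exact (h.not_isolated τ _ (he w) _ (hd τ w) (hab' ▸ hiso k)).elim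
    · have hab' : d σ v = Nat.nth (IsIsolated y) l := hab
      exact (h.not_isolated σ _ (he v) _ (hd σ v) (hab' ▸ hiso l)).elim
    · have hab' : d σ v = d τ w := hab
      obtain ⟨rfl, h'⟩ := h.denotes_inj σ τ _ _ (he v) (he w) _ (hd σ v) (hab' ▸ hd τ w)
      rw [h.nth_injective.comp_left (eq_of_heq h')]
  have hsurj : f.Surjective := by
    intro a
    rcases h.covered a with ha | ⟨σ, v, hv, ha⟩
    · obtain ⟨k, hk⟩ := (Nat.range_nth_of_infinite h.infinite_setOf_isIsolated).ge ha
      exact ⟨.inl k, hk⟩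
    · choose w hw using fun j => h.exists_nth (hv j)
      obtain rfl : e ∘ w = v := funext hw
      exact ⟨.inr ⟨σ, w⟩, h.denotes_unique σ _ hv _ _ (hd σ w) ha⟩
  refine ⟨⟨Equiv.ofBijective f ⟨hinj, hsurj⟩, ?_, ?_⟩⟩
  · rintro (k | ⟨σ, v⟩) b
    · exact iff_of_false (hiso k _).1 (by simp)
    rcases b with l | ⟨τ, w⟩
    · exact iff_of_false (hiso l _).2.1 (by simp)
    exact (h.edge_iff σ τ _ _ (he v) (he w) _ _ (hd σ v) (hd τ w)).trans
      (CoreEdge.comp_iff h.nth_injective σ τ v w)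
  · rintro (k | ⟨σ, v⟩) b
    · exact iff_of_false (hiso k _).2.2.1 (by simp)
    rcases b with l | ⟨τ, w⟩
    · exact iff_of_false (hiso l _).2.2.2 (by simp)
    exact (h.order_iff σ τ _ _ (he v) (he w) _ _ (hd σ v) (hd τ w)).trans
      (CoreOrder.comp_iff h.nth_injective (fun _ _ => Iff.rfl) σ τ v w)

end IsCoded

end BorelClass

/-! ### From structures with functions to relation families, and Borel measurability of the coding.
-/

namespace BorelClass

section Family

variable {L : FirstOrder.Language.{0, 0}}

/-- The arity of a symbol of `L` in the relational language in which functions are replaced by their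
graphs. -/
def symbolArity (L : FirstOrder.Language.{0, 0}) : L.Symbols → ℕ
  | .inl f => f.1 + 1
  | .inr R => R.1

/-- The graphs of the functions and the relations of a structure. -/
def Mod.family (x : Mod L) : RelFamily (symbolArity L)
  | .inl f, v => x.funMap f.2 (fun j => v (Fin.castSucc j)) = v (Fin.last f.1)
  | .inr R, v => x.RelMap R.2 v

theorem Mod.family_snoc (x : Mod L) {n : ℕ} (f : L.Functions n) (v : Fin n → ℕ) (a : ℕ) :
    x.family (.inl ⟨n, f⟩) (Fin.snoc (α := fun _ => ℕ) v a : Fin (n + 1) → ℕ) ↔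
      x.funMap f v = a := by
  simp [Mod.family]

theorem Mod.iso_iff_family_iso (x x' : Mod L) : Mod.Iso x x' ↔ x.family.Iso x'.family := by
  constructor
  · rintro ⟨g⟩
    refine ⟨@FirstOrder.Language.Equiv.toEquiv _ _ _ x x' g, ?_⟩
    rintro (⟨n, f⟩ | ⟨n, R⟩) v
    · have h := @FirstOrder.Language.Equiv.map_fun' _ _ _ x x' g n f (fun j => v (Fin.castSucc j))
      refine Iff.trans ?_ (Eq.congr_left h)
      exact (Equiv.apply_eq_iff_eq _).symm
    · exact (@FirstOrder.Language.Equiv.map_rel' _ _ _ x x' g n R v).symm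
  · rintro ⟨π, h⟩
    refine ⟨@FirstOrder.Language.Equiv.mk _ _ _ x x' π (fun {n} f v => ?_) fun {n} R v =>
      (h (.inr ⟨n, R⟩) v).symm⟩
    -- The graph of `f` is transported at the tuple `v` followed by its value.
    have h' : x'.funMap f (fun j => π (Fin.snoc (α := fun _ => ℕ) v (x.funMap f v) j.castSucc)) =
        π (Fin.snoc (α := fun _ => ℕ) v (x.funMap f v) (Fin.last n)) :=
      (h (.inl ⟨n, f⟩) _).1 ((x.family_snoc f v (x.funMap f v)).2 rfl)
    simp only [Fin.snoc_castSucc, Fin.snoc_last] at h'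
    exact h'.symm

theorem Mod.measurableSet_family (s : L.Symbols) (v : Fin (symbolArity L s) → ℕ) :
    MeasurableSet {x : Mod L | x.family s v} := by
  rcases s with f | R
  · exact Mod.measurable_funMap f.2 _ (measurableSet_singleton _)
  · exact Mod.measurableSet_relMap R.2 v

theorem Mod.measurable_of_family {Z : Type*} [MeasurableSpace Z] {F : Z → Mod L}
    (h : ∀ s v, MeasurableSet {z | (F z).family s v}) : Measurable F :=
  Mod.measurable_of (fun n f v w => by
      have hs : {z | (F z).family (.inl ⟨n, f⟩) (Fin.snoc (α := fun _ => ℕ) v w : Fin (n + 1) → ℕ)} =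
          {z | (F z).funMap f v = w} := Set.ext fun z => (F z).family_snoc f v w
      exact hs ▸ h (.inl ⟨n, f⟩) _)
    fun n R v => h (.inr ⟨n, R⟩) v

end Family

section Encode

variable {I : Type} {ar : I → ℕ} {idx : I → ℕ}

/-- The coding forest of a family of relations, with its nodes enumerated by `en`. -/
abbrev encode (en : Node ar ≃ ℕ) (idx : I → ℕ) (c : RelFamily ar) : Mod orderedGraphLang where
  funMap f := f.elim
  RelMap
    | .edge, v => NodeEdge ar (en.symm (v 0)) (en.symm (v 1))
    | .order, v => NodeOrder idx c (en.symm (v 0)) (en.symm (v 1))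

theorem nonempty_coding_encode (en : Node ar ≃ ℕ) (c : RelFamily ar) :
    Nonempty (Coding idx (encode en idx c) c) :=
  ⟨⟨en,
    fun a b => by
      change NodeEdge ar (en.symm (en a)) (en.symm (en b)) ↔ _
      rw [Equiv.symm_apply_apply, Equiv.symm_apply_apply],
    fun a b => by
      change NodeOrder idx c (en.symm (en a)) (en.symm (en b)) ↔ _
      rw [Equiv.symm_apply_apply, Equiv.symm_apply_apply]⟩⟩

theorem measurableSet_nodeOrder {Z : Type*} [MeasurableSpace Z] {c : Z → RelFamily ar}
    (hc : ∀ s v, MeasurableSet {z | c z s v}) (a b : Node ar) :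
    MeasurableSet {z | NodeOrder idx (c z) a b} := by
  induction a using Node.cases <;> induction b using Node.cases <;>
    try simp only [nodeOrder_inl_left, nodeOrder_inl_right, nodeOrder_top_top, nodeOrder_top_elt,
      nodeOrder_top_chain, nodeOrder_elt_top, nodeOrder_elt_elt, nodeOrder_elt_chain,
      nodeOrder_chain_top, nodeOrder_chain_elt, MeasurableSet.const]
  simp only [nodeOrder_chain_chain]
  exact (MeasurableSet.const _).inter ((MeasurableSet.const _).inter ((MeasurableSet.const _).inter
    ((MeasurableSet.const _).union ((MeasurableSet.const _).inter (hc _ _)))))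

theorem measurable_encode {Z : Type*} [MeasurableSpace Z] (en : Node ar ≃ ℕ)
    {c : Z → RelFamily ar} (hc : ∀ s v, MeasurableSet {z | c z s v}) :
    Measurable fun z => encode en idx (c z) := by
  refine Mod.measurable_of (fun n f => f.elim) fun n R v => ?_
  cases R with
  | edge => exact MeasurableSet.const _
  | order => exact measurableSet_nodeOrder hc _ _

/-- The `k`-th element is `a` iff `a` is an element with exactly `k` elements below it. Infinitude
of the set of elements keeps `Nat.nth` from taking its default value. -/
theorem measurable_nth_isElt {D : Set (Mod orderedGraphLang)} (hD : ∀ y ∈ D, IsCoded y ar idx)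
    (k : ℕ) : Measurable fun y : D => Nat.nth (IsElt y.1) k := by
  classical
  have helt : ∀ a, MeasurableSet {y : D | IsElt y.1 a} := fun a =>
    measurable_subtype_coe ((definable_isElt (0 : Fin 1)).measurableSet fun _ => a)
  have hcount : ∀ a, Measurable fun y : D => Nat.count (IsElt y.1) a := by
    intro a
    induction a with
    | zero => simp
    | succ a ih =>
      simp only [Nat.count_succ]
      exact ih.add (Measurable.ite (helt a) measurable_const measurable_const)
  refine measurable_to_countable' fun a => ?_
  have : (fun y : D => Nat.nth (IsElt y.1) k) ⁻¹' {a} =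
      {y : D | IsElt y.1 a} ∩ (fun y : D => Nat.count (IsElt y.1) a) ⁻¹' {k} := by
    ext y
    simp only [Set.mem_preimage, Set.mem_singleton_iff, Set.mem_inter_iff, Set.mem_ofPred_eq]
    constructor
    · rintro rfl
      exact ⟨(hD _ y.2).isElt_nth k,
        Nat.count_nth_of_infinite (hD _ y.2).infinite_setOf_isElt k⟩
    · rintro ⟨ha, rfl⟩
      exact Nat.nth_count ha
  rw [this]
  exact (helt a).inter (hcount a (measurableSet_singleton k))

theorem measurableSet_decode {D : Set (Mod orderedGraphLang)} (hD : ∀ y ∈ D, IsCoded y ar idx)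
    (s : I) (v : Fin (ar s) → ℕ) :
    MeasurableSet {y : D | (decode y.1 idx : RelFamily ar) s v} := by
  -- Conditioning on the countably many values of the enumerated tuple leaves `Holds` at a fixed
  -- tuple, which is definable.
  have : {y : D | (decode y.1 idx : RelFamily ar) s v} = ⋃ w : Fin (ar s) → ℕ,
      (⋂ j, (fun y : D => Nat.nth (IsElt y.1) (v j)) ⁻¹' {w j}) ∩ {y : D | Holds y.1 idx s w} := by
    ext y
    simp only [decode, Set.mem_ofPred_eq, Set.mem_iUnion, Set.mem_inter_iff, Set.mem_iInter,
      Set.mem_preimage, Set.mem_singleton_iff]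
    constructor
    · exact fun h => ⟨_, fun j => rfl, h⟩
    · rintro ⟨w, hw, h⟩
      rwa [show Nat.nth (IsElt y.1) ∘ v = w from funext hw]
  rw [this]
  exact MeasurableSet.iUnion fun w => (MeasurableSet.iInter fun j =>
    measurable_nth_isElt hD _ (measurableSet_singleton _)).inter
      (measurable_subtype_coe ((definable_holds s id).measurableSet w))

end Encode

/-! ### Translation of sentences about the structure into sentences about the forest. -/

section Translation

variable {L : FirstOrder.Language.{0, 0}}

/-- `a` is the value of the term in the structure coded by `y`. -/
def TermValue (y : Mod orderedGraphLang) (idx : L.Symbols → ℕ) {m : ℕ} :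
    L.Term (Fin m) → (Fin m → ℕ) → ℕ → Prop
  | .var i, v, a => a = v i
  | .func (l := k) f ts, v, a => ∃ w : Fin (k + 1) → ℕ, (∀ j, IsElt y (w j)) ∧
      (∀ j : Fin k, TermValue y idx (ts j) v (w j.castSucc)) ∧ a = w (Fin.last k) ∧
      Holds (ar := symbolArity L) y idx (.inl ⟨k, f⟩) w

/-- Satisfaction of an `L`-formula in the structure coded by `y`. -/
def CodeRealize (y : Mod orderedGraphLang) (idx : L.Symbols → ℕ) :
    {m : ℕ} → InfFormula L m → (Fin m → ℕ) → Prop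
  | _, .falsum, _ => False
  | _, .equal s t, v => ∃ a, IsElt y a ∧ TermValue y idx s v a ∧ TermValue y idx t v a
  | _, .rel (k := k) R ts, v => ∃ w : Fin k → ℕ, (∀ j, IsElt y (w j)) ∧
      (∀ j, TermValue y idx (ts j) v (w j)) ∧ Holds (ar := symbolArity L) y idx (.inr ⟨k, R⟩) w
  | _, .imp φ ψ, v => CodeRealize y idx φ v → CodeRealize y idx ψ v
  | _, .conj φ, v => ∀ i, CodeRealize y idx (φ i) v
  | _, .all φ, v => ∀ a, IsElt y a → CodeRealize y idx φ (Fin.snoc v a : Fin _ → ℕ)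

/-- The functions of the structure coded by `y` are well defined. -/
structure IsFunctional (L : FirstOrder.Language.{0, 0}) (y : Mod orderedGraphLang) (idx : L.Symbols → ℕ) :
    Prop where
  total : ∀ (f : Σ n, L.Functions n) (v : Fin f.1 → ℕ), (∀ j, IsElt y (v j)) →
    ∃ w : Fin (f.1 + 1) → ℕ, (∀ j, IsElt y (w j)) ∧ (∀ j, w (Fin.castSucc j) = v j) ∧
      Holds (ar := symbolArity L) y idx (.inl f) w
  unique : ∀ (f : Σ n, L.Functions n) (v w : Fin (f.1 + 1) → ℕ), (∀ j, IsElt y (v j)) →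
    (∀ j, IsElt y (w j)) → (∀ j, v (Fin.castSucc j) = w (Fin.castSucc j)) →
    Holds (ar := symbolArity L) y idx (.inl f) v → Holds (ar := symbolArity L) y idx (.inl f) w →
    v (Fin.last f.1) = w (Fin.last f.1)

section Definability

open Definable

variable {idx : L.Symbols → ℕ}

theorem definable_termValue {m : ℕ} (t : L.Term (Fin m)) : ∀ {n : ℕ} (f : Fin m → Fin n)
    (i : Fin n), Definable n (fun y u => TermValue y idx t (fun j => u (f j)) (u i)) := by
  induction t with
  | var k => exact fun f i => Definable.eq _ _
  | func g ts ih =>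
    intro n f i
    exact exTuple ((iAll fun j => definable_isElt _).and ((iAll fun j => ih j _ _).and
      ((Definable.eq _ _).and (definable_holds (ar := symbolArity L) (.inl ⟨_, g⟩) _))))

/-- The renaming `f` of variables is arbitrary because under a quantifier it has to be extended by
the new last variable. -/
theorem definable_codeRealize {m : ℕ} (φ : InfFormula L m) : ∀ {n : ℕ} (f : Fin m → Fin n),
    Definable n (fun y u => CodeRealize y idx φ (fun j => u (f j))) := by
  induction φ with
  | falsum => exact fun f => Definable.false
  | equal s t => exact fun f => ex ((definable_isElt _).and
      ((definable_termValue s _ _).and (definable_termValue t _ _)))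
  | rel R ts => exact fun f => exTuple ((iAll fun j => definable_isElt _).and
      ((iAll fun j => definable_termValue (ts j) _ _).and
        (definable_holds (ar := symbolArity L) (.inr ⟨_, R⟩) _)))
  | imp φ ψ h₁ h₂ => exact fun f => (h₁ f).imp (h₂ f)
  | conj φ h => exact fun f => iAll fun i => h i f
  | @all m φ h =>
    intro n f
    refine all ((definable_isElt _).imp ((h (Fin.snoc (α := fun _ => Fin (n + 1))
      (fun j => (f j).castSucc) (Fin.last n))).congr fun y u => ?_))
    have : (fun j => u (Fin.snoc (α := fun _ => Fin (n + 1)) (fun j => (f j).castSucc)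
        (Fin.last n) j)) = (Fin.snoc (fun j => u (f j).castSucc) (u (Fin.last n)) :
          Fin (m + 1) → ℕ) := by
      funext j
      refine Fin.lastCases ?_ (fun j => ?_) j <;> simp
    rw [this]

theorem definable_isFunctional [Countable L.Symbols] {n : ℕ} :
    Definable n (fun y _ => IsFunctional L y idx) := by
  have : Countable (Σ n, L.Functions n) :=
    Function.Injective.countable (β := L.Symbols) Sum.inl_injective
  have h₁ : Definable n (fun y _ => ∀ (f : Σ n, L.Functions n) (v : Fin f.1 → ℕ),
      (∀ j, IsElt y (v j)) → ∃ w : Fin (f.1 + 1) → ℕ, (∀ j, IsElt y (w j)) ∧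
        (∀ j, w (Fin.castSucc j) = v j) ∧ Holds (ar := symbolArity L) y idx (.inl f) w) :=
    iAll fun f => allTuple ((iAll fun j => definable_isElt _).imp
      (exTuple ((iAll fun j => definable_isElt _).and ((iAll fun j => Definable.eq _ _).and
        (definable_holds (ar := symbolArity L) (.inl f) _)))))
  have h₂ : Definable n (fun y _ => ∀ (f : Σ n, L.Functions n) (v w : Fin (f.1 + 1) → ℕ),
      (∀ j, IsElt y (v j)) → (∀ j, IsElt y (w j)) →
      (∀ j, v (Fin.castSucc j) = w (Fin.castSucc j)) →
      Holds (ar := symbolArity L) y idx (.inl f) v →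
      Holds (ar := symbolArity L) y idx (.inl f) w → v (Fin.last f.1) = w (Fin.last f.1)) :=
    iAll fun f => allTuple (allTuple ((iAll fun j => definable_isElt _).imp
      ((iAll fun j => definable_isElt _).imp ((iAll fun j => Definable.eq _ _).imp
        ((definable_holds (ar := symbolArity L) (.inl f) _).imp
          ((definable_holds (ar := symbolArity L) (.inl f) _).imp (Definable.eq _ _)))))))
  exact (h₁.and h₂).congr fun y _ => ⟨fun ⟨a, b⟩ => ⟨a, b⟩, fun ⟨a, b⟩ => ⟨a, b⟩⟩

end Definability

/-- `e` is an isomorphism of `x` with the structure coded by `y`. -/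
structure Presents (y : Mod orderedGraphLang) (idx : L.Symbols → ℕ) (x : Mod L) (e : ℕ → ℕ) :
    Prop where
  injective : e.Injective
  isElt : ∀ m, IsElt y (e m)
  exists_eq : ∀ a, IsElt y a → ∃ m, e m = a
  holds_iff : ∀ s v, Holds (ar := symbolArity L) y idx s (e ∘ v) ↔ x.family s v

namespace Presents

variable {y : Mod orderedGraphLang} {idx : L.Symbols → ℕ} {x : Mod L} {e : ℕ → ℕ}
  (h : Presents y idx x e)
include h

theorem exists_comp_eq {ι : Type*} {v : ι → ℕ} (hv : ∀ j, IsElt y (v j)) :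
    ∃ w : ι → ℕ, e ∘ w = v := by
  choose w hw using fun j => h.exists_eq _ (hv j)
  exact ⟨w, funext hw⟩

/-- Functions survive only as graphs, so a term is evaluated by guessing the values of its subterms
among the elements. -/
theorem termValue_iff {m : ℕ} (t : L.Term (Fin m)) (v : Fin m → ℕ) (a : ℕ) :
    TermValue y idx t (e ∘ v) (e a) ↔ a = @FirstOrder.Language.Term.realize L ℕ x (Fin m) v t := by
  induction t generalizing a with
  | var i => exact h.injective.eq_iff
  | @func k f ts ih =>
    simp only [TermValue, FirstOrder.Language.Term.realize]
    constructor
    · rintro ⟨w, hw, hts, ha, hf⟩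
      obtain ⟨w, rfl⟩ := h.exists_comp_eq hw
      have hf' := (h.holds_iff (.inl ⟨k, f⟩) w).1 hf
      simp only [Function.comp_apply] at hts ha
      rw [h.injective ha, show w (Fin.last k) = _ from Eq.symm hf']
      congr 1
      funext j
      exact (ih j _).1 (hts j)
    · intro ha
      let w : Fin (k + 1) → ℕ :=
        Fin.snoc (fun j => @FirstOrder.Language.Term.realize L ℕ x (Fin m) v (ts j)) a
      refine ⟨e ∘ w, fun j => h.isElt _, fun j => ?_, ?_, ?_⟩
      · simp only [Function.comp_apply]
        exact (ih j _).2 (by simp [w])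
      · simp [w]
      · exact (h.holds_iff (.inl ⟨k, f⟩) w).2 ((x.family_snoc f _ a).2 ha.symm)

/-- `e` is a bijection onto the element nodes, over which the translated quantifiers range. -/
theorem codeRealize_iff {m : ℕ} (φ : InfFormula L m) (v : Fin m → ℕ) :
    CodeRealize y idx φ (e ∘ v) ↔ @InfFormula.Realize L ℕ x m φ v := by
  induction φ with
  | falsum => exact Iff.rfl
  | equal s t =>
    simp only [CodeRealize, InfFormula.Realize]
    constructor
    · rintro ⟨a, ha, hs, ht⟩
      obtain ⟨a, rfl⟩ := h.exists_eq a ha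
      rw [← (h.termValue_iff s v a).1 hs, ← (h.termValue_iff t v a).1 ht]
    · exact fun hst => ⟨_, h.isElt _, (h.termValue_iff s v _).2 rfl, (h.termValue_iff t v _).2 hst⟩
  | @rel m k R ts =>
    simp only [CodeRealize, InfFormula.Realize]
    constructor
    · rintro ⟨w, hw, hts, hR⟩
      obtain ⟨w, rfl⟩ := h.exists_comp_eq hw
      have hR' := (h.holds_iff (.inr ⟨k, R⟩) w).1 hR
      rwa [show (fun i => @FirstOrder.Language.Term.realize L ℕ x (Fin m) v (ts i)) = w from
        funext fun j => ((h.termValue_iff (ts j) v _).1 (hts j)).symm]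
    · exact fun hR => ⟨_, fun j => h.isElt _, fun j => (h.termValue_iff (ts j) v _).2 rfl,
        (h.holds_iff (.inr ⟨k, R⟩) _).2 hR⟩
  | imp φ ψ h₁ h₂ => exact imp_congr (h₁ v) (h₂ v)
  | conj φ ih => exact forall_congr' fun i => ih i v
  | @all m φ ih =>
    have key : ∀ a, (Fin.snoc (e ∘ v) (e a) : Fin (m + 1) → ℕ) = e ∘ (Fin.snoc v a) := by
      intro a
      funext j
      refine Fin.lastCases ?_ (fun j => ?_) j <;> simp
    simp only [CodeRealize, InfFormula.Realize]
    constructor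
    · exact fun H a => (ih _).1 (key a ▸ H (e a) (h.isElt a))
    · intro H a ha
      obtain ⟨a, rfl⟩ := h.exists_eq a ha
      rw [key]
      exact (ih _).2 (H a)

theorem isFunctional : IsFunctional L y idx where
  total f v hv := by
    obtain ⟨v, rfl⟩ := h.exists_comp_eq hv
    let w : Fin (f.1 + 1) → ℕ := Fin.snoc v (x.funMap f.2 v)
    exact ⟨e ∘ w, fun j => h.isElt _, fun j => by simp [w],
      (h.holds_iff (.inl f) w).2 ((x.family_snoc f.2 v _).2 rfl)⟩
  unique f v w hv hw hvw hf hf' := by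
    obtain ⟨v, rfl⟩ := h.exists_comp_eq hv
    obtain ⟨w, rfl⟩ := h.exists_comp_eq hw
    have h₁ := (h.holds_iff (.inl f) v).1 hf
    have h₂ := (h.holds_iff (.inl f) w).1 hf'
    have h₃ : (fun j => v (Fin.castSucc j)) = fun j => w (Fin.castSucc j) :=
      funext fun j => h.injective (hvw j)
    simp only [Mod.family] at h₁ h₂
    rw [h₃] at h₁
    exact congrArg e (h₁.symm.trans h₂)

end Presents

theorem Coding.presents {y : Mod orderedGraphLang} {idx : L.Symbols → ℕ} (hidx : idx.Injective)
    {x : Mod L} (g : Coding idx y x.family) :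
    Presents y idx x fun m => g.toEquiv (eltNode _ m) where
  injective := g.elt_injective
  isElt m := (g.isElt_iff _).2 ⟨m, rfl⟩
  exists_eq a ha := by
    obtain ⟨w, hw⟩ := g.exists_eq_of_isElt (ι := Unit) (v := fun _ => a) fun _ => ha
    exact ⟨w (), (congrFun hw ()).symm⟩
  holds_iff := g.holds_iff hidx

/-- Totality provides a value for each function, and uniqueness shows that the relation decoded for
its symbol is the graph of that function. -/
theorem IsCoded.exists_structure {y : Mod orderedGraphLang} {idx : L.Symbols → ℕ}
    (h : IsCoded y (symbolArity L) idx) (hf : IsFunctional L y idx) :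
    ∃ x : Mod L, x.family = decode y idx := by
  let e := Nat.nth (IsElt y)
  have he : ∀ {k} (v : Fin k → ℕ) (j), IsElt y ((e ∘ v) j) := fun v j => h.isElt_nth _
  have key : ∀ (f : Σ n, L.Functions n) (v : Fin f.1 → ℕ), ∃ w : Fin (f.1 + 1) → ℕ,
      (∀ j, w (Fin.castSucc j) = v j) ∧
        Holds (ar := symbolArity L) y idx (.inl f) (e ∘ w) := by
    intro f v
    obtain ⟨w, hw, hwv, hw'⟩ := hf.total f (e ∘ v) (he v)
    choose w₀ hw₀ using fun j => h.exists_nth (hw j)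
    obtain rfl : e ∘ w₀ = w := funext hw₀
    exact ⟨w₀, fun j => h.nth_injective (hwv j), hw'⟩
  choose W hW hW' using key
  refine ⟨⟨fun {n} f v => W ⟨n, f⟩ v (Fin.last n),
    fun {n} R v => Holds (ar := symbolArity L) y idx (.inr ⟨n, R⟩) (e ∘ v)⟩, ?_⟩
  funext s v
  rcases s with f | R
  · refine propext ⟨fun hv => ?_, fun hv => ?_⟩
    · have : W f (fun j => v (Fin.castSucc j)) = v := by
        funext j
        refine Fin.lastCases ?_ (fun j => ?_) j
        · exact hv
        · exact hW f _ j
      have h' := hW' f (fun j => v (Fin.castSucc j))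
      rw [this] at h'
      exact h'
    · exact h.nth_injective (hf.unique f _ _ (he _) (he _)
        (fun j => congrArg e (hW f _ j)) (hW' f _) hv)
  · rfl

theorem IsCoded.presents {y : Mod orderedGraphLang} {idx : L.Symbols → ℕ}
    (h : IsCoded y (symbolArity L) idx) {x : Mod L} (hx : x.family = decode y idx) :
    Presents y idx x (Nat.nth (IsElt y)) where
  injective := h.nth_injective
  isElt := h.isElt_nth
  exists_eq _ ha := h.exists_nth ha
  holds_iff s v := by rw [hx]; rfl

end Translation

/-! ### Composition of reductions, and the main construction. -/

section Reducibility

variable {X Y Z : Type*} [MeasurableSpace X] [MeasurableSpace Y] [MeasurableSpace Z]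
  {E : Setoid X} {F : Setoid Y} {H : Setoid Z}

theorem BorelReducible.trans (h : BorelReducible E F) (h' : BorelReducible F H) :
    BorelReducible E H := by
  obtain ⟨f, hf, hf'⟩ := h
  obtain ⟨g, hg, hg'⟩ := h'
  exact ⟨g ∘ f, hg.comp hf, fun x x' => (hf' x x').trans (hg' _ _)⟩

theorem BorelBireducible.trans (h : BorelBireducible E F) (h' : BorelBireducible F H) :
    BorelBireducible E H :=
  ⟨h.1.trans h'.1, h'.2.trans h.2⟩

theorem ClasswiseBorelIsomorphic.trans (h : ClasswiseBorelIsomorphic E F)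
    (h' : ClasswiseBorelIsomorphic F H) : ClasswiseBorelIsomorphic E H := by
  obtain ⟨e, ⟨f, hf, hf'⟩, g, hg, hg'⟩ := h
  obtain ⟨e₁, ⟨f₁, hf₁, hf₁'⟩, g₁, hg₁, hg₁'⟩ := h'
  exact ⟨e.trans e₁, ⟨f₁ ∘ f, hf₁.comp hf, fun x => by simp [hf', hf₁']⟩,
    g ∘ g₁, hg.comp hg₁, fun y => by simp [hg', hg₁']⟩

/-- A lifting of an injective map between quotients is a reduction. -/
theorem ClasswiseBorelIsomorphic.bireducible (h : ClasswiseBorelIsomorphic E F) :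
    BorelBireducible E F := by
  obtain ⟨e, ⟨f, hf, hf'⟩, g, hg, hg'⟩ := h
  refine ⟨⟨f, hf, fun x x' => ?_⟩, g, hg, fun y y' => ?_⟩
  · exact Quotient.eq.symm.trans (e.injective.eq_iff.symm.trans
      ((Eq.congr (hf' x) (hf' x')).trans Quotient.eq))
  · exact Quotient.eq.symm.trans (e.symm.injective.eq_iff.symm.trans
      ((Eq.congr (hg' y) (hg' y')).trans Quotient.eq))

theorem ClasswiseBorelIsomorphic.of_maps {f : X → Y} {g : Y → X} (hf : Measurable f)
    (hg : Measurable g) (hfE : ∀ x x', E x x' → F (f x) (f x'))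
    (hgF : ∀ y y', F y y' → E (g y) (g y')) (hgf : ∀ x, E (g (f x)) x)
    (hfg : ∀ y, F (f (g y)) y) : ClasswiseBorelIsomorphic E F :=
  ⟨⟨Quotient.map f fun x x' => hfE x x', Quotient.map g fun y y' => hgF y y',
      fun q => q.inductionOn fun x => Quotient.sound (hgf x),
      fun q => q.inductionOn fun y => Quotient.sound (hfg y)⟩,
    ⟨f, hf, fun _ => rfl⟩, g, hg, fun _ => rfl⟩

end Reducibility

/-- The isomorphism relation on every elementary class is classwise Borel isomorphic to the one on
an elementary class of ordered trees which are weak-epimorphic images of each other. -/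
theorem exists_class_of_trees {L : FirstOrder.Language.{0, 0}} [Countable L.Symbols] {C : Set (Mod L)}
    (hC : IsElementaryClass C) :
    ∃ D : Set (Mod orderedGraphLang), IsElementaryClass D ∧ (∀ z ∈ D, IsOrderedTree z) ∧
      (∀ z₁ ∈ D, ∀ z₂ ∈ D, Mod.WeakEpiLE z₁ z₂) ∧
      ClasswiseBorelIsomorphic (isoRel C) (isoRel D) := by
  obtain ⟨φ, rfl⟩ := hC
  obtain ⟨idx, hidx⟩ := exists_injective_nat L.Symbols
  -- The nodes and their enumeration do not depend on the structure; only the second relation does,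
  -- at the truth flags.
  obtain ⟨en⟩ : Nonempty (Node (symbolArity L) ≃ ℕ) := nonempty_equiv_of_countable
  let D : Set (Mod orderedGraphLang) :=
    {y | IsCoded y (symbolArity L) idx ∧ IsFunctional L y idx ∧ CodeRealize y idx φ Fin.elim0}
  have hcoding : ∀ y ∈ D, Nonempty (Coding idx y (decode y idx : RelFamily (symbolArity L))) :=
    fun y hy => hy.1.nonempty_coding
  have hD : IsElementaryClass D := by
    refine (((definable_isCoded _ _).and (definable_isFunctional.and
      (definable_codeRealize φ id))).congr (Q := fun y v => IsCoded y (symbolArity L) idx ∧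
        IsFunctional L y idx ∧ CodeRealize y idx φ v) fun y v => Iff.rfl).isElementaryClass
  -- The choice does no harm to measurability: the relation family of `F y` is prescribed to be
  -- `decode y idx`.
  choose F hF using fun y : D => y.2.1.exists_structure y.2.2.1
  have hFC : ∀ y : D, F y ∈ {x : Mod L | x.Sat φ} := by
    intro y
    have h := (y.2.1.presents (hF y)).codeRealize_iff φ Fin.elim0
    refine h.1 ?_
    rw [Subsingleton.elim (_ ∘ _) Fin.elim0]
    exact y.2.2.2
  have hencode : ∀ x : Mod L, Nonempty (Coding idx (encode en idx x.family) x.family) :=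
    fun x => nonempty_coding_encode en _
  have hGD : ∀ x : {x : Mod L | x.Sat φ}, encode en idx x.1.family ∈ D := by
    intro x
    obtain ⟨g⟩ := hencode x.1
    refine ⟨g.isCoded hidx, (g.presents hidx).isFunctional, ?_⟩
    have h := ((g.presents hidx).codeRealize_iff φ Fin.elim0).2 x.2
    rwa [Subsingleton.elim (_ ∘ _) Fin.elim0] at h
  refine ⟨D, hD, fun z hz => ?_, fun z₁ h₁ z₂ h₂ => ?_,
    .of_maps (f := fun x => ⟨encode en idx x.1.family, hGD x⟩) (g := fun y => ⟨F y, hFC y⟩)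
      ?_ ?_ ?_ ?_ ?_ ?_⟩
  · exact (hcoding z hz).some.isOrderedTree
  · exact (hcoding z₁ h₁).some.weakEpiLE (hcoding z₂ h₂).some
  · exact (measurable_encode en fun s v =>
      measurable_subtype_coe (Mod.measurableSet_family s v)).subtype_mk
  · refine (Mod.measurable_of_family fun s v => ?_).subtype_mk
    simp only [hF]
    exact measurableSet_decode (fun y hy => hy.1) s v
  · intro x x' hx
    obtain ⟨g⟩ := (hencode x'.1).some.of_family_iso ((Mod.iso_iff_family_iso _ _).1 hx)
    exact (hencode x.1).some.iso g
  · intro y y' hy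
    obtain ⟨g⟩ := (hcoding y y.2).some.of_iso hy
    refine (Mod.iso_iff_family_iso _ _).2 ?_
    rw [hF y, hF y']
    exact g.family_iso hidx (hcoding y' y'.2).some
  · intro x
    refine (Mod.iso_iff_family_iso _ _).2 ?_
    rw [hF _]
    exact (hcoding _ (hGD x)).some.family_iso hidx (hencode x.1).some
  · intro y
    have g := (hencode (F y)).some
    exact g.iso (hF y ▸ (hcoding y y.2).some)

end BorelClass

theorem theorem4p1 {X : Type*} [MeasurableSpace X] [StandardBorelSpace X] (E : Setoid X)
    (hE : BorelClass.IsQuasiIsomorphismRelation E) :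
    ∃ C : Set (BorelClass.Mod BorelClass.orderedGraphLang),
      BorelClass.IsElementaryClass C ∧
      (∀ z ∈ C, BorelClass.IsOrderedTree z) ∧
      BorelClass.BorelBireducible E (BorelClass.isoRel C) ∧
      (∀ z₁ ∈ C, ∀ z₂ ∈ C, BorelClass.Mod.WeakEpiLE z₁ z₂) ∧
      (BorelClass.IsIsomorphismRelation E →
        BorelClass.ClasswiseBorelIsomorphic E (BorelClass.isoRel C)) := by
  -- One class has to serve both conclusions. If `E` is an isomorphism relation, the class must be
  -- built from a presentation of `E` itself, since one that is only bireducible with `E` would not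
  -- give the classwise Borel isomorphism.
  by_cases hiso : BorelClass.IsIsomorphismRelation E
  · obtain ⟨L, hL, C, hC, e, he⟩ := hiso
    obtain ⟨D, hD, htree, hepi, hCD⟩ := BorelClass.exists_class_of_trees hC
    have hEC : BorelClass.ClasswiseBorelIsomorphic E (BorelClass.isoRel C) :=
      .of_maps e.measurable e.symm.measurable (fun x x' => (he x x').1)
        (fun y y' h => (he _ _).2 (by simpa using h)) (fun x => by simp)
        (fun y => by simp)
    exact ⟨D, hD, htree, (hEC.trans hCD).bireducible, hepi, fun _ => hEC.trans hCD⟩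
  · obtain ⟨L, hL, C, hC, hEC⟩ := hE
    obtain ⟨D, hD, htree, hepi, hCD⟩ := BorelClass.exists_class_of_trees hC
    exact ⟨D, hD, htree, hEC.trans hCD.bireducible, hepi, fun h => (hiso h).elim⟩
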